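/- **Definitions.** Let $k$ be a field and $\mathbb N=\{1,2,3,\dots\}$. Let $\mathsf{Vect}$ denote either the category of all $k$-vector spaces or the category of finite-dimensional $k$-vector spaces. * $\mathcal{ZZ}_{\mathbb N}$ is the poset with underlying set $\tfrac12\mathbb N=\{\tfrac12,1,\tfrac32,\dots\}$ whose non-identity relations are $\tfrac a2\le\tfrac{a+1}2$ and, if $a>1$, $\tfrac a2\le\tfrac{a-1}2$, for $a\in\mathbb N$ odd. * $\mathsf{Poset}_I$ is the category of at most countable posets whose Hasse diagram (vertices: the elements; edges: the covering relations; regarded as a one-dimensional complex) is homeomorphic to a closed interval, a half-closed interval or $\mathbb R$. Its morphisms are the surjective monotone maps. It contains $\mathcal{ZZ}_{\mathbb N}$. * The category $\mathsf{ZZmod}$ of marked zig-zag modules has as objects the pairs $(q:\mathcal{ZZ}_{\mathbb N}\twoheadrightarrow P,\ \rho:P\to\mathsf{Vect})$, where $q$ is an object of the under category $\mathsf{Poset}_I^{\mathcal{ZZ}_{\mathbb N}/}$ and $\rho$ is a functor. A morphism $(q:\mathcal{ZZ}_{\mathbb N}\twoheadrightarrow P,\rho)\to(r:\mathcal{ZZ}_{\mathbb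 N}\twoheadrightarrow Q,\eta)$ is a pair $(f,\varphi)$ of a morphism $f:P\twoheadrightarrow Q$ under $\mathcal{ZZ}_{\mathbb N}$ and a natural transformation $\varphi:\rho\Rightarrow f^*\eta$. It is a weak equivalence if $\varphi$ is a natural isomorphism; $\mathcal W$ is the class of weak equivalences. * $(\mathbb R,\mathbb N)^{\wedge}$ is the real line with its connected ambient stratification: the strata are the points $\{n\}$, $n\in\mathbb N$, and the connected components of $\mathbb R\setminus\mathbb N$, and $\{n\}\le\alpha$ if $n\in\overline\alpha$. The category $\mathsf{Ent}_\Delta((\mathbb R,\mathbb N)^{\wedge})$ has the strata as objects and a unique morphism $\sigma\to\tau$ if $\tau$ is a face of $\sigma$ (that is, $\tau\subseteq\overline\sigma$), and none otherwise. * A cosheaf of vector spaces on a space $X$ is a functor $F$ from the poset of open sets of $X$ to $k$-vector spaces such that, for every family of open sets $(U_i)$ with union $U$, the diagram $\coprod_{i,j}F(U_i\cap U_j)\rightrightarrows\coprod_iF(U_i)\to F(U)$ is a coequalizer. On a stratified space it is constructible if its restriction to every stratum is locally constant (where restriction to a subspace $A$ is $W\mapsto\lim_{V\supseteq W}F(V)$,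 $V$ open in $X$, for $W$ open in $A$). $\mathsf{cShv}_{cbl}^{\mathsf{Vect}}$ is the category of constructible cosheaves of vector spaces; if $\mathsf{Vect}$ is the category of finite-dimensional vector spaces, it is the full subcategory of those whose costalks $\lim_{U\ni x}F(U)$ are all finite-dimensional. **Theorem.** 1. Sending $z\in\tfrac12\mathbb N$ to the stratum that contains the real number $z$ defines an isomorphism $\mathcal{ZZ}_{\mathbb N}\cong\mathsf{Ent}_\Delta((\mathbb R,\mathbb N)^{\wedge})$; restriction along it is an isomorphism of categories $\mathsf{Fun}(\mathsf{Ent}_\Delta((\mathbb R,\mathbb N)^{\wedge}),\mathsf{Vect})\cong\mathsf{Fun}(\mathcal{ZZ}_{\mathbb N},\mathsf{Vect})$. 2. The functor $\mathsf{ZZmod}\to\mathsf{Fun}(\mathcal{ZZ}_{\mathbb N},\mathsf{Vect})$, $(q,\rho)\mapsto q^*\rho$, sends weak equivalences to isomorphisms, and the functor $\mathsf{ZZmod}[\mathcal W^{-1}]\to\mathsf{Fun}(\mathcal{ZZ}_{\mathbb N},\mathsf{Vect})$ that it induces is an equivalence of categories which has a strict section (a functor in the other direction such that the composite on $\mathsf{Fun}(\mathcal{ZZ}_{\mathbb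 N},\mathsf{Vect})$ is equal to the identity). 3. There is an equivalence of categories $\mathsf{Fun}(\mathsf{Ent}_\Delta((\mathbb R,\mathbb N)^{\wedge}),\mathsf{Vect})\simeq\mathsf{cShv}_{cbl}^{\mathsf{Vect}}((\mathbb R,\mathbb N)^{\wedge})$. In particular $\mathsf{ZZmod}[\mathcal W^{-1}]$, $\mathsf{Fun}(\mathcal{ZZ}_{\mathbb N},\mathsf{Vect})$, $\mathsf{Fun}(\mathsf{Ent}_\Delta((\mathbb R,\mathbb N)^{\wedge}),\mathsf{Vect})$ and $\mathsf{cShv}_{cbl}^{\mathsf{Vect}}((\mathbb R,\mathbb N)^{\wedge})$ are equivalent categories. -/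

import Mathlib

open CategoryTheory CategoryTheory.Limits TopologicalSpace

universe u v

/-! ### Hasse diagrams as one-dimensional complexes -/

namespace HasseDiagram

/-- The edges of the Hasse diagram of `P`: pairs `(a, b)` such that `b` covers `a`. -/
structure Edge (P : Type v) [PartialOrder P] where
  lo : P
  hi : P
  cov : lo ⋖ hi

/-- The disjoint union of one point for each element of `P` and one copy of `[0, 1]` for each
edge of the Hasse diagram. -/
def Pieces (P : Type v) [PartialOrder P] : Type v :=
  P ⊕ (Edge P × unitInterval)

/-- The vertices and the edge labels are discrete. -/
instance (P : Type v) [PartialOrder P] : TopologicalSpace (Pieces P) :=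
  letI : TopologicalSpace P := ⊥
  letI : TopologicalSpace (Edge P) := ⊥
  inferInstanceAs (TopologicalSpace (P ⊕ (Edge P × unitInterval)))

/-- The gluing of the end points of the edges to the vertices. -/
inductive Glue (P : Type v) [PartialOrder P] : Pieces P → Pieces P → Prop
  | lo (e : Edge P) : Glue P (Sum.inr (e, 0)) (Sum.inl e.lo)
  | hi (e : Edge P) : Glue P (Sum.inr (e, 1)) (Sum.inl e.hi)

/-- The Hasse diagram of `P`, as a one-dimensional complex, with the quotient topology. -/
def Realization (P : Type v) [PartialOrder P] : Type v := Quot (Glue P)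

instance (P : Type v) [PartialOrder P] : TopologicalSpace (Realization P) :=
  inferInstanceAs (TopologicalSpace (Quot (Glue P)))

end HasseDiagram

/-- A poset is zig-zag if its Hasse diagram is homeomorphic to the closed interval, the half-closed
interval or the real line. -/
def IsZigZagPoset (P : Type v) [PartialOrder P] : Prop :=
  Nonempty (HasseDiagram.Realization P ≃ₜ Set.Icc (0 : ℝ) 1) ∨
  Nonempty (HasseDiagram.Realization P ≃ₜ Set.Ico (0 : ℝ) 1) ∨
  Nonempty (HasseDiagram.Realization P ≃ₜ ℝ)

/-! ### The category of zig-zag posets and surjective monotone maps -/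

/-- Countable zig-zag posets. -/
structure PosetI : Type 1 where
  carrier : Type
  [order : PartialOrder carrier]
  [countable : Countable carrier]
  isZigZag : IsZigZagPoset carrier

namespace PosetI

attribute [instance] PosetI.order PosetI.countable

/-- Surjective monotone maps. -/
@[ext]
structure Hom (P Q : PosetI) : Type where
  toOrderHom : P.carrier →o Q.carrier
  surjective : Function.Surjective toOrderHom

instance : Category PosetI where
  Hom := Hom
  id P := ⟨OrderHom.id, Function.surjective_id⟩
  comp f g := ⟨g.toOrderHom.comp f.toOrderHom, g.surjective.comp f.surjective⟩

/-- A morphism of zig-zag posets, as a functor between the associated categories. -/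
def Hom.functor {P Q : PosetI} (f : P ⟶ Q) : P.carrier ⥤ Q.carrier :=
  (Hom.toOrderHom f).monotone.functor

end PosetI

/-! ### The poset of positive half-integers -/

/-- The set `{1/2, 1, 3/2, 2, …}`; the number `a / 2` is stored as its numerator `a`. -/
@[ext]
structure ZZN : Type where
  num : ℕ
  pos : 0 < num

namespace ZZN

/-- The non-identity relations are `a/2 ≤ (a+1)/2` and `a/2 ≤ (a-1)/2` for `a` odd. -/
instance : PartialOrder ZZN where
  le x y := x = y ∨ (Odd x.num ∧ (y.num = x.num + 1 ∨ y.num + 1 = x.num))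
  le_refl x := Or.inl rfl
  le_trans x y z := by
    rintro (rfl | ⟨hx, hxy⟩) (rfl | ⟨hy, hyz⟩)
    · exact Or.inl rfl
    · exact Or.inr ⟨hy, hyz⟩
    · exact Or.inr ⟨hx, hxy⟩
    · exfalso
      rw [Nat.odd_iff] at hx hy
      omega
  le_antisymm x y := by
    rintro (rfl | ⟨hx, hxy⟩) (h | ⟨hy, hyz⟩)
    · rfl
    · rfl
    · exact h.symm
    · exfalso
      rw [Nat.odd_iff] at hx hy
      omega

theorem le_iff {x y : ZZN} :
    x ≤ y ↔ x = y ∨ (Odd x.num ∧ (y.num = x.num + 1 ∨ y.num + 1 = x.num)) := Iff.rfl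

/-- The real number `a / 2`. -/
noncomputable def toReal (z : ZZN) : ℝ := (z.num : ℝ) / 2

instance : Countable ZZN :=
  Function.Injective.countable (f := ZZN.num) (fun _ _ h => ZZN.ext h)

end ZZN

namespace ZZN
open HasseDiagram

theorem covBy_iff {x y : ZZN} :
    x ⋖ y ↔ Odd x.num ∧ (y.num = x.num + 1 ∨ y.num + 1 = x.num) := by
  constructor
  · intro h
    rcases h.le with rfl | h'
    · exact absurd h.lt (lt_irrefl _)
    · exact h'
  · intro h
    have hne : x ≠ y := by
      rintro rfl
      omega
    refine ⟨lt_of_le_of_ne (Or.inr h) hne, ?_⟩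
    intro c hxc hcy
    rcases hxc.le with rfl | ⟨hx, hc⟩
    · exact lt_irrefl _ hxc
    rcases hcy.le with rfl | ⟨hc', hc''⟩
    · exact lt_irrefl _ hcy
    rw [Nat.odd_iff] at hx hc'
    omega

/-- The edge of the Hasse diagram between `a/2` and `(a+1)/2`. -/
def edge (a : ℕ) (ha : 0 < a) : Edge ZZN :=
  if h : Odd a then ⟨⟨a, ha⟩, ⟨a + 1, a.succ_pos⟩, covBy_iff.2 ⟨h, Or.inl rfl⟩⟩
  else ⟨⟨a + 1, a.succ_pos⟩, ⟨a, ha⟩, covBy_iff.2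
    ⟨by rw [Nat.not_odd_iff_even] at h; exact h.add_one, Or.inr rfl⟩⟩

/-- The position of a point of a piece of the Hasse diagram on the half line `[1, ∞)`. -/
noncomputable def posPieces : Pieces ZZN → ℝ
  | Sum.inl z => z.num
  | Sum.inr (e, t) => (1 - t) * e.lo.num + t * e.hi.num

theorem continuous_posPieces : Continuous posPieces := by
  let _ : TopologicalSpace ZZN := ⊥
  have _ : DiscreteTopology ZZN := ⟨rfl⟩
  let _ : TopologicalSpace (Edge ZZN) := ⊥
  have _ : DiscreteTopology (Edge ZZN) := ⟨rfl⟩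
  refine continuous_sum_dom.2 ⟨continuous_of_discreteTopology, ?_⟩
  have h1 : Continuous fun e : Edge ZZN => (e.lo.num : ℝ) := continuous_of_discreteTopology
  have h2 : Continuous fun e : Edge ZZN => (e.hi.num : ℝ) := continuous_of_discreteTopology
  change Continuous fun p : Edge ZZN × unitInterval =>
    (1 - (p.2 : ℝ)) * (p.1.lo.num : ℝ) + (p.2 : ℝ) * (p.1.hi.num : ℝ)
  fun_prop

theorem posPieces_glue {x y : Pieces ZZN} (h : Glue ZZN x y) : posPieces x = posPieces y := by
  cases h <;> simp [posPieces]

theorem one_le_posPieces (x : Pieces ZZN) : 1 ≤ posPieces x := by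
  rcases x with z | ⟨e, t⟩
  · have := z.pos
    simp only [posPieces]
    exact_mod_cast this
  · have h1 : (1 : ℝ) ≤ e.lo.num := by exact_mod_cast e.lo.pos
    have h2 : (1 : ℝ) ≤ e.hi.num := by exact_mod_cast e.hi.pos
    have h3 := t.2.1
    have h4 := t.2.2
    simp only [posPieces]
    nlinarith

/-- The position on the half line `[1, ∞)` of a point of the Hasse diagram. -/
noncomputable def position : Realization ZZN → Set.Ici (1 : ℝ) :=
  Quot.lift (fun x => ⟨posPieces x, one_le_posPieces x⟩)
    (fun _ _ h => Subtype.ext (posPieces_glue h))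

theorem continuous_position : Continuous position :=
  continuous_quot_lift _ (continuous_posPieces.subtype_mk _)

/-- The point of the edge from `a/2` to `(a+1)/2` that lies at position `t` (clamped). -/
noncomputable def onEdge (a : ℕ) (ha : 0 < a) (t : ℝ) : Realization ZZN :=
  Quot.mk _ (Sum.inr (edge a ha, Set.projIcc 0 1 zero_le_one (if Odd a then t - a else a + 1 - t)))

theorem continuous_onEdge (a : ℕ) (ha : 0 < a) : Continuous (onEdge a ha) := by
  let _ : TopologicalSpace ZZN := ⊥
  let _ : TopologicalSpace (Edge ZZN) := ⊥
  have h : Continuous fun t : ℝ =>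
      ((edge a ha, Set.projIcc 0 1 zero_le_one (if Odd a then t - a else a + 1 - t)) :
        Edge ZZN × unitInterval) := by
    refine continuous_const.prodMk (continuous_projIcc.comp ?_)
    split_ifs <;> fun_prop
  exact continuous_quot_mk.comp ((continuous_inr (X := ZZN)).comp h)

theorem onEdge_left (a : ℕ) (ha : 0 < a) :
    onEdge a ha a = Quot.mk _ (Sum.inl (⟨a, ha⟩ : ZZN)) := by
  unfold onEdge
  by_cases h : Odd a
  · have h0 := Quot.sound (Glue.lo (edge a ha))
    simp only [edge, h, dite_true] at h0 ⊢
    rw [← h0]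
    simp
    rfl
  · have h0 := Quot.sound (Glue.hi (edge a ha))
    simp only [edge, h, dite_false] at h0 ⊢
    rw [← h0]
    simp
    rfl

theorem onEdge_right (a : ℕ) (ha : 0 < a) :
    onEdge a ha (a + 1) = Quot.mk _ (Sum.inl (⟨a + 1, a.succ_pos⟩ : ZZN)) := by
  unfold onEdge
  by_cases h : Odd a
  · have h0 := Quot.sound (Glue.hi (edge a ha))
    simp only [edge, h, dite_true] at h0 ⊢
    rw [← h0]
    simp
    rfl
  · have h0 := Quot.sound (Glue.lo (edge a ha))
    simp only [edge, h, dite_false] at h0 ⊢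
    rw [← h0]
    simp
    rfl

theorem floor_pos (t : Set.Ici (1 : ℝ)) : 0 < ⌊(t : ℝ)⌋₊ := Nat.floor_pos.2 t.2

/-- The point of the Hasse diagram at a given position. -/
noncomputable def atPosition (t : Set.Ici (1 : ℝ)) : Realization ZZN :=
  onEdge ⌊(t : ℝ)⌋₊ (floor_pos t) t

theorem atPosition_eq (a : ℕ) (ha : 0 < a) (t : Set.Ici (1 : ℝ)) (h1 : (a : ℝ) ≤ t)
    (h2 : (t : ℝ) ≤ a + 1) : atPosition t = onEdge a ha t := by
  rcases h2.lt_or_eq with h2 | h2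
  · have h : ⌊(t : ℝ)⌋₊ = a := (Nat.floor_eq_iff (by linarith [t.2.out])).2 ⟨h1, h2⟩
    subst h
    rfl
  · have h : ⌊(t : ℝ)⌋₊ = a + 1 := by
      rw [h2]; exact_mod_cast Nat.floor_natCast (R := ℝ) (a + 1)
    have key : ∀ (n : ℕ) (hn : 0 < n), n = a + 1 → onEdge n hn (a + 1) =
        Quot.mk _ (Sum.inl (⟨a + 1, a.succ_pos⟩ : ZZN)) := by
      rintro n hn rfl
      exact_mod_cast onEdge_left (a + 1) hn
    have h3 : onEdge a ha t = Quot.mk _ (Sum.inl (⟨a + 1, a.succ_pos⟩ : ZZN)) := by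
      rw [h2, onEdge_right]
    rw [← h2] at key
    exact (key _ _ h).trans h3.symm

theorem continuous_atPosition : Continuous atPosition := by
  let f : ℕ → Set (Set.Ici (1 : ℝ)) := fun n => {t | ((n + 1 : ℕ) : ℝ) ≤ t ∧ (t : ℝ) ≤ (n + 1 : ℕ) + 1}
  have hlf : LocallyFinite f := by
    intro t
    refine ⟨{s | (s : ℝ) < t + 1}, (isOpen_lt (by fun_prop) (by fun_prop)).mem_nhds (by simp), ?_⟩
    refine (Set.finite_le_nat ⌈(t : ℝ) + 1⌉₊).subset ?_
    rintro n ⟨s, hs1, hs2⟩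
    have h1 : ((n + 1 : ℕ) : ℝ) ≤ s := hs1.1
    have h2 : (s : ℝ) < t + 1 := hs2
    have h3 := Nat.le_ceil ((t : ℝ) + 1)
    push_cast at h1
    have : (n : ℝ) ≤ ⌈(t : ℝ) + 1⌉₊ := by linarith
    exact_mod_cast this
  refine hlf.continuous ?_ ?_ ?_
  · refine Set.eq_univ_of_forall fun t => Set.mem_iUnion.2 ⟨⌊(t : ℝ)⌋₊ - 1, ?_⟩
    have h := floor_pos t
    have h' : ⌊(t : ℝ)⌋₊ - 1 + 1 = ⌊(t : ℝ)⌋₊ := by omega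
    refine ⟨?_, ?_⟩
    · rw [h']; exact Nat.floor_le (by linarith [t.2.out])
    · rw [h']; exact (Nat.lt_floor_add_one _).le
  · intro n
    exact (isClosed_le continuous_const continuous_subtype_val).inter
      (isClosed_le continuous_subtype_val continuous_const)
  · intro n
    refine ((continuous_onEdge (n + 1) n.succ_pos).comp
      continuous_subtype_val).continuousOn.congr ?_
    intro t ht
    exact atPosition_eq _ _ t ht.1 ht.2

theorem position_onEdge (a : ℕ) (ha : 0 < a) (t : ℝ) (h1 : (a : ℝ) ≤ t) (h2 : t ≤ a + 1) :
    (position (onEdge a ha t) : ℝ) = t := by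
  change posPieces (Sum.inr (edge a ha,
    Set.projIcc 0 1 zero_le_one (if Odd a then t - a else a + 1 - t))) = t
  by_cases h : Odd a
  · have : t - a ∈ Set.Icc (0 : ℝ) 1 := ⟨by linarith, by linarith⟩
    simp only [posPieces, edge, h, dite_true, if_true, Set.projIcc_of_mem _ this]
    push_cast
    ring
  · have : (a : ℝ) + 1 - t ∈ Set.Icc (0 : ℝ) 1 := ⟨by linarith, by linarith⟩
    simp only [posPieces, edge, h, dite_false, if_false, Set.projIcc_of_mem _ this]
    push_cast
    ring

theorem position_atPosition (t : Set.Ici (1 : ℝ)) : position (atPosition t) = t :=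
  Subtype.ext (position_onEdge _ _ _ (Nat.floor_le (by linarith [t.2.out]))
    (Nat.lt_floor_add_one _).le)

theorem atPosition_position (x : Realization ZZN) : atPosition (position x) = x := by
  rcases x with ⟨z | ⟨e, t⟩⟩
  · have h : atPosition (position (Quot.mk _ (Sum.inl z))) = onEdge z.num z.pos z.num :=
      atPosition_eq z.num z.pos _ le_rfl (by change (z.num : ℝ) ≤ _; linarith)
    exact h.trans (onEdge_left _ _)
  · have ht0 := t.2.1
    have ht1 := t.2.2
    obtain ⟨⟨a, ha⟩, ⟨b, hb⟩, hc⟩ := e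
    obtain ⟨hodd, hab | hab⟩ := covBy_iff.1 hc
    · simp only at hodd hab
      subst hab
      have hp : (position (Quot.mk _ (Sum.inr (⟨⟨a, ha⟩, ⟨a + 1, hb⟩, hc⟩, t))) : ℝ) = a + t := by
        have hp' : posPieces (Sum.inr (⟨⟨a, ha⟩, ⟨a + 1, hb⟩, hc⟩, t)) = a + t := by
          simp only [posPieces]; push_cast; ring
        exact hp'
      have h := atPosition_eq a ha (position (Quot.mk _ (Sum.inr (⟨⟨a, ha⟩, ⟨a + 1, hb⟩, hc⟩, t))))
        (by rw [hp]; linarith)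
        (by rw [hp]; linarith)
      refine h.trans ?_
      rw [hp]
      simp only [onEdge, edge, hodd, dite_true, if_true, add_sub_cancel_left, Set.projIcc_val]
      rfl
    · simp only at hodd hab
      subst hab
      have hodd' : ¬ Odd b := by
        rw [Nat.odd_iff] at *; omega
      have hp : (position (Quot.mk _ (Sum.inr (⟨⟨b + 1, ha⟩, ⟨b, hb⟩, hc⟩, t))) : ℝ) = b + 1 - t := by
        have hp' : posPieces (Sum.inr (⟨⟨b + 1, ha⟩, ⟨b, hb⟩, hc⟩, t)) = b + 1 - t := by
          simp only [posPieces]; push_cast; ring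
        exact hp'
      have h := atPosition_eq b hb (position (Quot.mk _ (Sum.inr (⟨⟨b + 1, ha⟩, ⟨b, hb⟩, hc⟩, t))))
        (by rw [hp]; linarith)
        (by rw [hp]; linarith)
      refine h.trans ?_
      rw [hp]
      simp only [onEdge, edge, hodd', dite_false, if_false, sub_sub_cancel, Set.projIcc_val]
      rfl

/-- The Hasse diagram of the poset of half-integers is a half line. -/
noncomputable def homeoHalfLine : Realization ZZN ≃ₜ Set.Ici (1 : ℝ) where
  toFun := position
  invFun := atPosition
  left_inv := atPosition_position
  right_inv := position_atPosition
  continuous_toFun := continuous_position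
  continuous_invFun := continuous_atPosition

/-- The half line is a half-closed interval. -/
noncomputable def halfLineHomeo : Set.Ici (1 : ℝ) ≃ₜ Set.Ico (0 : ℝ) 1 where
  toFun t := ⟨1 - (t : ℝ)⁻¹, by
    have h : (1 : ℝ) ≤ t := t.2
    have h1 := inv_le_one_of_one_le₀ h
    have h2 : 0 < (t : ℝ)⁻¹ := by positivity
    exact ⟨by linarith, by linarith⟩⟩
  invFun s := ⟨(1 - (s : ℝ))⁻¹, by
    have h1 : (0 : ℝ) ≤ s := s.2.1
    have h2 : (s : ℝ) < 1 := s.2.2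
    have h3 : (0 : ℝ) < 1 - s := sub_pos.2 h2
    exact (one_le_inv₀ h3).2 (by simpa using h1)⟩
  left_inv t := by ext; simp
  right_inv s := by ext; simp
  continuous_toFun := by
    refine Continuous.subtype_mk (continuous_const.sub (continuous_subtype_val.inv₀ ?_)) _
    intro t
    have h : (1 : ℝ) ≤ t := t.2
    positivity
  continuous_invFun := by
    refine Continuous.subtype_mk ((continuous_const.sub continuous_subtype_val).inv₀ ?_) _
    intro s
    have h2 : (s : ℝ) < 1 := s.2.2
    exact (sub_pos.2 h2).ne'

theorem isZigZagPoset : IsZigZagPoset ZZN :=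
  Or.inr (Or.inl ⟨homeoHalfLine.trans halfLineHomeo⟩)

/-- The poset of half-integers, as a zig-zag poset. -/
abbrev asPosetI : PosetI := ⟨ZZN, isZigZagPoset⟩

end ZZN

/-! ### Marked zig-zag modules -/

/-- A marked zig-zag module with values in `C`: a zig-zag poset `P` under the poset of
half-integers, with a representation of `P` in `C`. -/
structure ZZMod (C : Type u) [Category.{v} C] where
  base : Under ZZN.asPosetI
  rep : base.right.carrier ⥤ C

namespace ZZMod

variable {C : Type u} [Category.{v} C]

/-- A morphism `(P, ρ) ⟶ (Q, η)`: a morphism `f : P ⟶ Q` in the under category and a natural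
transformation `ρ ⟶ f^* η`. -/
@[ext]
structure Hom (X Y : ZZMod C) where
  base : X.base ⟶ Y.base
  trans : X.rep ⟶ base.right.functor ⋙ Y.rep

theorem paste_squares {a₁ a₂ a₃ b₁ b₂ b₃ : C} {p : a₁ ⟶ b₁} {f : b₁ ⟶ b₂} {f' : a₁ ⟶ a₂}
    {q : a₂ ⟶ b₂} {g : b₂ ⟶ b₃} {g' : a₂ ⟶ a₃} {r : a₃ ⟶ b₃} (h₁ : p ≫ f = f' ≫ q)
    (h₂ : q ≫ g = g' ≫ r) : p ≫ f ≫ g = (f' ≫ g') ≫ r := by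
  rw [← Category.assoc, h₁, Category.assoc, h₂, Category.assoc]

theorem paste_triangle {a b b' c c' d : C} {f : a ⟶ b} {g : b ⟶ c} {l : c ⟶ d} {m : b ⟶ b'}
    {g' : b' ⟶ c'} {m' : c' ⟶ d} {n : c ⟶ c'} (h₁ : m ≫ g' = g ≫ n) (h₂ : n ≫ m' = l) :
    (f ≫ g) ≫ l = (f ≫ m) ≫ g' ≫ m' := by
  rw [← h₂, Category.assoc, Category.assoc, ← Category.assoc m, h₁, Category.assoc]

/-- The composite of `(f, φ)` and `(g, ψ)` is `(f ≫ g, φ ≫ f^* ψ)`. -/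
instance : Category (ZZMod C) where
  Hom := Hom
  id X := ⟨𝟙 X.base, { app := fun p => 𝟙 (X.rep.obj p)
                       naturality := fun _ _ f => by
                        exact (Category.comp_id _).trans (Category.id_comp _).symm }⟩
  comp {X Y Z} f g := ⟨f.base ≫ g.base,
    { app := fun p => f.trans.app p ≫ g.trans.app (f.base.right.functor.obj p)
      naturality := fun p q h => by
        exact paste_squares (f.trans.naturality h)
          (g.trans.naturality (f.base.right.functor.map h)) }⟩
  id_comp f := by
    refine Hom.ext (Category.id_comp _) (heq_of_eq ?_)
    ext p
    exact Category.id_comp _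
  comp_id f := by
    refine Hom.ext (Category.comp_id _) (heq_of_eq ?_)
    ext p
    exact Category.comp_id _
  assoc f g h := by
    refine Hom.ext (Category.assoc _ _ _) (heq_of_eq ?_)
    ext p
    exact Category.assoc _ _ _

variable (C)

/-- The weak equivalences: the morphisms `(f, φ)` such that `φ` is a natural isomorphism. -/
def weakEquivalences : MorphismProperty (ZZMod C) :=
  fun _ _ f => IsIso (Hom.trans f)

variable {C}

theorem Hom.w {X Y : ZZMod C} (f : X ⟶ Y) (z : ZZN) :
    (Hom.base f).right.functor.obj (X.base.hom.functor.obj z) = Y.base.hom.functor.obj z :=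
  congrArg (fun g : ZZN.asPosetI ⟶ Y.base.right => (PosetI.Hom.toOrderHom g) z)
    (Under.w (Hom.base f))

variable (C)

/-- The functor that sends `(q : ZZN ↠ P, ρ)` to the representation `q^* ρ` of the poset of
half-integers, and `(f, φ) : (q, ρ) ⟶ (r, η)` to `q^* φ : q^* ρ ⟶ q^* f^* η = r^* η`. -/
def pullback : ZZMod C ⥤ (ZZN ⥤ C) where
  obj X := X.base.hom.functor ⋙ X.rep
  map {X Y} f :=
    { app := fun z => (Hom.trans f).app (X.base.hom.functor.obj z) ≫
        Y.rep.map (homOfLE (Hom.w f z).le)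
      naturality := fun z w h => by
        refine paste_squares ((Hom.trans f).naturality (X.base.hom.functor.map h)) ?_
        change Y.rep.map _ ≫ Y.rep.map _ = Y.rep.map _ ≫ Y.rep.map _
        rw [← Y.rep.map_comp, ← Y.rep.map_comp]
        rfl }
  map_id X := by
    ext z
    change 𝟙 _ ≫ X.rep.map (𝟙 _) = 𝟙 _
    simp
  map_comp {X Y Z} f g := by
    ext z
    refine paste_triangle ((Hom.trans g).naturality (homOfLE (Hom.w f z).le)) ?_
    exact (Z.rep.map_comp _ _).symm

end ZZMod

/-! ### Stratified spaces -/

/-- A stratification of a paracompact Hausdorff space `X` by a poset `P`: a map `X → P` that is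
continuous for the topology on `P` whose open sets are the upward closed sets. -/
structure Stratification (X : Type u) [TopologicalSpace X] [T2Space X] [ParacompactSpace X]
    (P : Type v) [PartialOrder P] where
  toFun : X → P
  isOpen_preimage : ∀ U : Set P, IsUpperSet U → IsOpen (toFun ⁻¹' U)

namespace Stratification

variable {X : Type u} [TopologicalSpace X] [T2Space X] [ParacompactSpace X]
  {P : Type v} [PartialOrder P]

/-- The stratum of index `p`. -/
def stratum (s : Stratification X P) (p : P) : Set X := s.toFun ⁻¹' {p}

/-- The objects of the combinatorial entrance path category: the (non-empty) strata. -/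
@[ext]
structure Ent (s : Stratification X P) where
  index : P
  nonempty : (s.stratum index).Nonempty

/-- There is a unique morphism `σ ⟶ τ` if `τ` is a face of `σ`, that is, if the stratum `τ` lies
in the closure of the stratum `σ`. -/
instance (s : Stratification X P) : Preorder s.Ent where
  le σ τ := s.stratum τ.index ⊆ closure (s.stratum σ.index)
  le_refl _ := subset_closure
  le_trans _ _ _ h₁ h₂ := h₂.trans (closure_minimal h₁ isClosed_closure)

/-- The stratum that contains the point `x`. -/
def entOf (s : Stratification X P) (x : X) : s.Ent := ⟨s.toFun x, x, rfl⟩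

end Stratification

/-! ### The connected ambient stratification -/

section Ambient

variable {X : Type u} [TopologicalSpace X] {S : Set X} {Q : Type v}

/-- The set underlying the poset of the connected ambient stratification of `X` that is induced by
`φ : S → Q`: the disjoint union of `Q` and the set of connected components of `X \ S`. -/
inductive Ambient (φ : S → Q) : Type (max u v)
  | stratum (q : Q) : Ambient φ
  | component (α : ConnectedComponents ↥Sᶜ) : Ambient φ

namespace Ambient

/-- The subset of `X` given by a connected component of `X \ S`. -/
def componentSet (α : ConnectedComponents ↥Sᶜ) : Set X :=
  Subtype.val '' {y : ↥Sᶜ | ConnectedComponents.mk y = α}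

/-- The subset of `X` given by a stratum of `S`. -/
def stratumSet (φ : S → Q) (q : Q) : Set X := Subtype.val '' (φ ⁻¹' {q})

variable [PartialOrder Q]

/-- The order generated by the order of `Q` and by the relations `q ≤ α` whenever the stratum `q`
lies in the closure of the component `α`. -/
inductive Le (φ : S → Q) : Ambient φ → Ambient φ → Prop
  | stratum {q r : Q} (h : q ≤ r) : Le φ (stratum q) (stratum r)
  | mixed {q r : Q} {α : ConnectedComponents ↥Sᶜ} (h : q ≤ r)
      (h' : stratumSet φ r ⊆ closure (componentSet α)) : Le φ (stratum q) (component α)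
  | component (α : ConnectedComponents ↥Sᶜ) : Le φ (component α) (component α)

instance (φ : S → Q) : PartialOrder (Ambient φ) where
  le := Le φ
  le_refl x := by
    cases x with
    | stratum q => exact Le.stratum le_rfl
    | component α => exact Le.component α
  le_trans x y z h₁ h₂ := by
    cases h₁ with
    | stratum h =>
      cases h₂ with
      | stratum h₂ => exact Le.stratum (h.trans h₂)
      | mixed h₂ h' => exact Le.mixed (h.trans h₂) h'
    | mixed h h' =>
      cases h₂ with
      | component => exact Le.mixed h h'
    | component => exact h₂
  le_antisymm x y h₁ h₂ := by
    cases h₁ with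
    | stratum h =>
      cases h₂ with
      | stratum h₂ => rw [le_antisymm h h₂]
    | mixed h h' => cases h₂
    | component => rfl

open Classical in
/-- The extension of `φ` to `X`. -/
noncomputable def map (φ : S → Q) (x : X) : Ambient φ :=
  if h : x ∈ S then stratum (φ ⟨x, h⟩) else component (ConnectedComponents.mk ⟨x, h⟩)

end Ambient

end Ambient

/-! ### The real line stratified by the natural numbers -/

/-- The subset `{1, 2, 3, …}` of the real line. -/
def natSet : Set ℝ := {x | ∃ n : ℕ, 0 < n ∧ x = n}

/-- The points of `natSet`, as a poset without non-identity relations. -/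
@[ext]
structure NatPoint : Type where
  val : natSet

instance : PartialOrder NatPoint where
  le x y := x = y
  le_refl _ := rfl
  le_trans _ _ _ := Eq.trans
  le_antisymm _ _ h _ := h

/-- The native stratification of the discrete space `natSet`: every point is a stratum. -/
def natNative : natSet → NatPoint := NatPoint.mk

theorem isClosed_natSet : IsClosed natSet := by
  have h : natSet = (Nat.cast : ℕ → ℝ) '' {n | 0 < n} := by
    ext x
    constructor
    · rintro ⟨n, hn, rfl⟩
      exact ⟨n, hn, rfl⟩
    · rintro ⟨n, hn, rfl⟩
      exact ⟨n, hn, rfl⟩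
  rw [h]
  exact Nat.isClosedEmbedding_coe_real.isClosedMap _ (isClosed_discrete _)

theorem eq_of_abs_sub_lt_one {x y : ℝ} (hx : x ∈ natSet) (hy : y ∈ natSet) (h : |y - x| < 1) :
    y = x := by
  obtain ⟨n, -, rfl⟩ := hx
  obtain ⟨m, -, rfl⟩ := hy
  have h' : |(m : ℤ) - n| < 1 := by exact_mod_cast h
  have := Int.abs_lt_one_iff.1 h'
  have : m = n := by omega
  rw [this]

/-- If a segment that ends at `x` meets `natSet` only in `x`, then `x` lies in the closure of the
component that contains the rest of the segment. -/
theorem mem_closure_component {x y : ℝ}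
    (h : ∀ t : ℝ, 0 < t → t ≤ 1 → x + t * (y - x) ∉ natSet) (hy : y ∉ natSet) :
    x ∈ closure (Ambient.componentSet (S := natSet) (ConnectedComponents.mk ⟨y, hy⟩)) := by
  have hseg : ∀ t : ℝ, ∀ h0 : 0 < t, ∀ h1 : t ≤ 1,
      (ConnectedComponents.mk (⟨x + t * (y - x), h t h0 h1⟩ : ↥natSetᶜ)) =
        ConnectedComponents.mk ⟨y, hy⟩ := by
    let g : Set.Ioc (0 : ℝ) 1 → ↥natSetᶜ := fun t => ⟨x + t * (y - x), h t t.2.1 t.2.2⟩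
    have hg : Continuous g := Continuous.subtype_mk (by fun_prop) _
    have hc : PreconnectedSpace (Set.Ioc (0 : ℝ) 1) :=
      isPreconnected_iff_preconnectedSpace.1 isPreconnected_Ioc
    intro t h0 h1
    have h2 : g ⟨t, h0, h1⟩ ∈ connectedComponent (g ⟨1, one_pos, le_rfl⟩) :=
      (isPreconnected_range hg).subset_connectedComponent ⟨_, rfl⟩ ⟨_, rfl⟩
    have h3 : g ⟨1, one_pos, le_rfl⟩ = ⟨y, hy⟩ := by
      apply Subtype.ext
      change x + 1 * (y - x) = y
      ring
    rw [h3] at h2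
    exact ConnectedComponents.coe_eq_coe'.2 h2
  have hlim : Filter.Tendsto (fun n : ℕ => x + (1 / ((n : ℝ) + 1)) * (y - x)) Filter.atTop
      (nhds (x + 0 * (y - x))) :=
    (tendsto_one_div_add_atTop_nhds_zero_nat.mul_const _).const_add _
  rw [zero_mul, add_zero] at hlim
  refine mem_closure_of_tendsto hlim (Filter.Eventually.of_forall fun n => ?_)
  have h0 : (0 : ℝ) < 1 / ((n : ℝ) + 1) := by positivity
  have h1 : 1 / ((n : ℝ) + 1) ≤ 1 := by
    rw [div_le_one (by positivity)]
    have : (0 : ℝ) ≤ n := n.cast_nonneg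
    linarith
  exact ⟨_, hseg _ h0 h1, rfl⟩

/-- The connected ambient stratification of the real line that is induced by `{1, 2, 3, …}`. -/
noncomputable def realStrat : Stratification ℝ (Ambient natNative) where
  toFun := Ambient.map natNative
  isOpen_preimage U hU := by
    rw [isOpen_iff_mem_nhds]
    intro x hx
    by_cases hxS : x ∈ natSet
    · refine Filter.mem_of_superset (Metric.ball_mem_nhds x one_pos) fun y hy => ?_
      rw [Metric.mem_ball, Real.dist_eq] at hy
      by_cases hyx : x = y
      · subst hyx
        exact hx
      have hseg : ∀ t : ℝ, 0 < t → t ≤ 1 → x + t * (y - x) ∉ natSet := by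
        intro t h0 h1 hmem
        have h2 : |x + t * (y - x) - x| < 1 := by
          rw [add_sub_cancel_left, abs_mul, abs_of_pos h0]
          nlinarith [abs_nonneg (y - x)]
        have h3 := eq_of_abs_sub_lt_one hxS hmem h2
        have h4 : t * (y - x) = 0 := by linarith
        rcases mul_eq_zero.1 h4 with h5 | h5
        · exact h0.ne' h5
        · exact hyx (sub_eq_zero.1 h5).symm
      have hyS : y ∉ natSet := by
        have := hseg 1 one_pos le_rfl
        rwa [one_mul, add_sub_cancel] at this
      refine hU ?_ hx
      have e1 : Ambient.map natNative x = .stratum (natNative ⟨x, hxS⟩) := dif_pos hxS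
      have e2 : Ambient.map natNative y = .component (ConnectedComponents.mk ⟨y, hyS⟩) :=
        dif_neg hyS
      rw [e1, e2]
      refine Ambient.Le.mixed le_rfl ?_
      rintro _ ⟨z, hz, rfl⟩
      have hz' : z = ⟨x, hxS⟩ := congrArg NatPoint.val hz
      subst hz'
      exact mem_closure_component hseg hyS
    · have hopen : IsOpen natSetᶜ := isClosed_natSet.isOpen_compl
      refine Filter.mem_of_superset
        ((hopen.connectedComponentIn (x := x)).mem_nhds (mem_connectedComponentIn hxS)) ?_
      intro y hy
      rw [connectedComponentIn_eq_image hxS] at hy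
      obtain ⟨z, hz, rfl⟩ := hy
      have e1 : Ambient.map natNative x = .component (ConnectedComponents.mk ⟨x, hxS⟩) :=
        dif_neg hxS
      have e2 : Ambient.map natNative (z : ℝ) = .component (ConnectedComponents.mk z) :=
        dif_neg z.2
      have e3 : (ConnectedComponents.mk z) = ConnectedComponents.mk ⟨x, hxS⟩ :=
        ConnectedComponents.coe_eq_coe'.2 hz
      change Ambient.map natNative (z : ℝ) ∈ U
      rw [e2, e3, ← e1]
      exact hx

/-! ### Constructible cosheaves -/

namespace Cosheaf

variable {C : Type u} [Category.{v} C]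

section

variable [HasColimitsOfSize.{0, 0} C] {X : TopCat.{0}}

/-- A precosheaf `F` is a cosheaf if, for every family `U i` of open sets with union `U`, the
diagram `∐ F (U i ⊓ U j) ⇉ ∐ F (U i) → F U` is a coequalizer. -/
def IsCosheaf (F : Opens X ⥤ C) : Prop :=
  ∀ (ι : Type) (U : ι → Opens X), Nonempty (IsColimit (Cofork.ofπ
    (f := Sigma.desc fun p : ι × ι => F.map (Opens.infLELeft (U p.1) (U p.2)) ≫
      Sigma.ι (fun i => F.obj (U i)) p.1)
    (g := Sigma.desc fun p : ι × ι => F.map (Opens.infLERight (U p.1) (U p.2)) ≫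
      Sigma.ι (fun i => F.obj (U i)) p.2)
    (Sigma.desc fun i => F.map (Opens.leSupr U i))
    (by
      ext p
      simp only [colimit.ι_desc_assoc, Cofan.mk_ι_app, Category.assoc, colimit.ι_desc,
        ← F.map_comp]
      rfl)))

/-- The functor that sends an open set to its set of connected components. -/
def components (X : TopCat.{0}) : Opens X ⥤ Type where
  obj U := ConnectedComponents U
  map {U V} h := TypeCat.ofHom (Continuous.connectedComponentsMap
    (f := fun x : U => (⟨x.1, h.le x.2⟩ : V)) (by fun_prop))
  map_id U := by
    ext x
    obtain ⟨x, rfl⟩ := ConnectedComponents.surjective_coe x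
    rfl
  map_comp f g := by
    ext x
    obtain ⟨x, rfl⟩ := ConnectedComponents.surjective_coe x
    rfl

/-- The constant cosheaf with value `V` on a (locally connected) space: an open set is sent to the
coproduct of copies of `V` indexed by its connected components. -/
noncomputable def constant (X : TopCat.{0}) (V : C) : Opens X ⥤ C :=
  components X ⋙ sigmaConst.obj V

end

section

variable [HasLimitsOfSize.{0, 0} C] {X Y : TopCat.{0}}

/-- The pullback of `F` along `f : X ⟶ Y`: its value on `U` is the limit of `F V` over the open
sets `V` with `U ≤ f ⁻¹' V`, i.e. over the open sets that contain `f '' U`. -/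
noncomputable def pullback (f : X ⟶ Y) (F : Opens Y ⥤ C) : Opens X ⥤ C :=
  (Opens.map f).pointwiseRightKanExtension F

/-- The restriction of `F` to a subspace. -/
noncomputable def restrict (F : Opens X ⥤ C) (A : Set X) : Opens (TopCat.of A) ⥤ C :=
  pullback (TopCat.ofHom ⟨Subtype.val, continuous_subtype_val⟩ : TopCat.of A ⟶ X) F

/-- The costalk of `F` at `x`: the limit of `F U` over the open neighbourhoods `U` of `x`. -/
noncomputable def costalk (F : Opens X ⥤ C) (x : X) : C :=
  limit (OpenNhds.inclusion x ⋙ F)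

variable [HasColimitsOfSize.{0, 0} C]

/-- Every point has an open neighbourhood on which `F` is isomorphic to a constant cosheaf. -/
def IsLocallyConstant (F : Opens X ⥤ C) : Prop :=
  ∀ x : X, ∃ U : Opens X, x ∈ U ∧
    ∃ V : C, Nonempty (restrict F (U : Set X) ≅ constant (TopCat.of (U : Set X)) V)

end

variable [HasLimitsOfSize.{0, 0} C] [HasColimitsOfSize.{0, 0} C]
variable {X : Type} [TopologicalSpace X] [T2Space X] [ParacompactSpace X]
  {P : Type} [PartialOrder P]

variable (C) in
/-- The constructible cosheaves on a stratified space: the cosheaves whose restriction to every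
stratum is locally constant. -/
def isConstructible (s : Stratification X P) : ObjectProperty (Opens (TopCat.of X) ⥤ C) :=
  fun F => IsCosheaf F ∧ ∀ p : P, IsLocallyConstant (restrict F (s.stratum p))

/-- The constructible cosheaves of vector spaces with finite-dimensional costalks. -/
def isConstructibleFinite (k : Type u) [Field k] (s : Stratification X P) :
    ObjectProperty (Opens (TopCat.of X) ⥤ ModuleCat.{u} k) :=
  fun F => isConstructible (ModuleCat.{u} k) s F ∧
    ∀ x : X, FiniteDimensional k (costalk (X := TopCat.of X) F x : ModuleCat.{u} k)

end Cosheaf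

/-- The category of `C`-valued constructible cosheaves on a stratified space. -/
abbrev ConstructibleCosheaf {X : Type} [TopologicalSpace X] [T2Space X] [ParacompactSpace X]
    {P : Type} [PartialOrder P] (s : Stratification X P) (C : Type u) [Category.{v} C]
    [HasLimitsOfSize.{0, 0} C] [HasColimitsOfSize.{0, 0} C] :=
  (Cosheaf.isConstructible C s).FullSubcategory

/-- The category of constructible cosheaves of `k`-vector spaces with finite-dimensional
costalks on a stratified space. -/
abbrev FiniteConstructibleCosheaf {X : Type} [TopologicalSpace X] [T2Space X]
    [ParacompactSpace X] {P : Type} [PartialOrder P] (s : Stratification X P) (k : Type u)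
    [Field k] :=
  (Cosheaf.isConstructibleFinite k s).FullSubcategory

/-!
The three parts of the theorem are independent of each other.

The index `ZZN.cell x` of the stratum of a real number `x` is a monotone function of `x`, which
makes strata and open stars intervals. That `x` is a limit of points of a stratum `z` means
`z ≤ cell x`; this gives the isomorphism `ZZN.entIso` with the entrance path category.

For marked modules, the surjection `q : ZZN ⟶ P` is itself a weak equivalence from the module
`q^* ρ` with the trivial marking to `(q, ρ)`. Hence, after inverting weak equivalences, the functor
`ZZMod.unmarked` that adds the trivial marking becomes inverse to the pullback functor
(`ZZMod.isEquivalence_lift_pullback`), and it is a strict section from the start.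

For cosheaves, the functor sends `F` to its values on the open stars `ZZN.star z`, which are open
intervals and increase with `z`. The cosheaf condition says that `Hom (F -, T)` is a sheaf of sets
for every `T` (`Cosheaf.isCosheaf_iff_hasDescent`). A cosheaf is constructible if and only if it
does not change when an interval is shrunk without losing the smallest stratum that it meets
(`Cosheaf.isConstructible_iff`): local constancy gives this for short intervals, and maps out of
`F` are continued along an interval by a connectedness argument (`ZZN.IsBasic.induction`). So a
constructible cosheaf is known on all intervals contained in stars and meeting the smallest stratum
of the star, up to isomorphism, from its values on stars. These intervals are a basis of the
topology, and descent makes the restriction to stars fully faithful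
(`Cosheaf.exists_hom_of_star`, `Cosheaf.hom_ext_star`). A representation `ρ` is the restriction of
its left Kan extension from the basis, `Cosheaf.extend ρ`; descent for it comes down to germs, one
map out of `ρ (cell x)` for each point `x`, which propagate along intervals
(`Cosheaf.hasDescent_extend`). Finally the costalk at `x` is the value on the star of `cell x`
(`Cosheaf.isIso_costalkπ`), so that finite-dimensional representations correspond to
finite-dimensional costalks.
-/

/-! ### The strata of the real line -/

namespace ZZN

/-- The index of the stratum that contains `x`: the point `n` has index `2n / 2`, the interval
`(n, n + 1)` has index `(2n + 1) / 2`, and everything below `1` has index `1 / 2`. -/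
noncomputable def cell (x : ℝ) : ZZN := ⟨max 1 (⌊x⌋₊ + ⌈x⌉₊), by omega⟩

theorem cell_num_mono : Monotone (ZZN.num ∘ cell) := fun _ _ h =>
  max_le_max le_rfl (add_le_add (Nat.floor_mono h) (Nat.ceil_mono h))

theorem cell_of_lt_one {x : ℝ} (h : x < 1) : (cell x).num = 1 := by
  have h1 : ⌊x⌋₊ = 0 := Nat.floor_eq_zero.2 h
  have h2 : ⌈x⌉₊ ≤ 1 := Nat.ceil_le.2 (by simpa using h.le)
  simp only [cell]
  omega

theorem cell_natCast (n : ℕ) : (cell ((n : ℝ) + 1)).num = 2 * n + 2 := by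
  have h1 : ⌊(n : ℝ) + 1⌋₊ = n + 1 := by exact_mod_cast Nat.floor_natCast (R := ℝ) (n + 1)
  have h2 : ⌈(n : ℝ) + 1⌉₊ = n + 1 := by exact_mod_cast Nat.ceil_natCast (R := ℝ) (n + 1)
  simp only [cell]
  omega

theorem cell_of_between {x : ℝ} (n : ℕ) (h : (n : ℝ) < x) (h' : x < n + 1) :
    (cell x).num = 2 * n + 1 := by
  have h1 : ⌊x⌋₊ = n := (Nat.floor_eq_iff (by linarith [n.cast_nonneg (α := ℝ)])).2 ⟨h.le, h'⟩
  have h2 : ⌈x⌉₊ = n + 1 := (Nat.ceil_eq_iff (by omega)).2 ⟨by simpa using h, by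
    push_cast; exact h'.le⟩
  simp only [cell]
  omega

/-- A real number is below `1`, or a positive integer, or strictly between two of these. -/
theorem trichotomy (x : ℝ) :
    x < 1 ∨ (∃ n : ℕ, x = n + 1) ∨ ∃ n : ℕ, (n : ℝ) + 1 < x ∧ x < n + 2 := by
  rcases lt_or_ge x 1 with h | h
  · exact Or.inl h
  right
  obtain ⟨n, hn⟩ : ∃ n, ⌊x⌋₊ = n + 1 :=
    ⟨⌊x⌋₊ - 1, by have := Nat.floor_pos.2 h; omega⟩
  obtain ⟨h1, h2⟩ := (Nat.floor_eq_iff (by linarith)).1 hn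
  push_cast at h1 h2
  rcases h1.eq_or_lt with h1 | h1
  · exact Or.inl ⟨n, h1.symm⟩
  · exact Or.inr ⟨n, h1, by linarith⟩

theorem cell_of_between' {x : ℝ} (n : ℕ) (h : (n : ℝ) + 1 < x) (h' : x < n + 2) :
    (cell x).num = 2 * n + 3 := by
  have := cell_of_between (x := x) (n + 1) (by push_cast; exact h) (by push_cast; linarith)
  omega

theorem eq_of_even_cell {x : ℝ} (h : ¬ Odd (cell x).num) : x = (cell x).toReal := by
  rcases trichotomy x with hx | ⟨n, rfl⟩ | ⟨n, h1, h2⟩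
  · rw [cell_of_lt_one hx] at h; exact absurd odd_one h
  · rw [toReal, cell_natCast]; push_cast; ring
  · rw [cell_of_between' n h1 h2] at h
    exact absurd ⟨n + 1, by ring⟩ h

theorem eq_of_cell_eq_of_even {x y : ℝ} (h : cell x = cell y) (hx : ¬ Odd (cell x).num) :
    x = y := by
  exact (eq_of_even_cell hx).trans ((congrArg toReal h).trans (eq_of_even_cell (h ▸ hx)).symm)

theorem cell_toReal (z : ZZN) : cell z.toReal = z := by
  obtain ⟨a, ha⟩ := z
  ext
  change (cell ((a : ℝ) / 2)).num = a
  rcases Nat.even_or_odd' a with ⟨m, rfl | rfl⟩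
  · obtain ⟨n, rfl⟩ : ∃ n, m = n + 1 := ⟨m - 1, by omega⟩
    have : (((2 * (n + 1) : ℕ) : ℝ) / 2) = n + 1 := by push_cast; ring
    rw [this, cell_natCast]
    ring
  · exact cell_of_between m (by push_cast; linarith) (by push_cast; linarith)

/-- The stratum of `x` lies in the closure of the strata of the points near `x`. -/
theorem eventually_cell_le (x : ℝ) : ∀ᶠ y in nhds x, cell y ≤ cell x := by
  rcases trichotomy x with hx | ⟨n, rfl⟩ | ⟨n, h1, h2⟩
  · filter_upwards [Iio_mem_nhds hx] with y hy
    exact (ZZN.ext ((cell_of_lt_one hy).trans (cell_of_lt_one hx).symm)).le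
  · filter_upwards [Ioo_mem_nhds (show (n : ℝ) < n + 1 by linarith)
      (show (n : ℝ) + 1 < n + 2 by linarith)] with y hy
    rcases lt_trichotomy y (n + 1) with h | rfl | h
    · have h3 := cell_of_between n hy.1 h
      have h4 := cell_natCast n
      exact Or.inr ⟨⟨n, h3⟩, Or.inl (by omega)⟩
    · exact le_rfl
    · have h3 := cell_of_between' n h hy.2
      have h4 := cell_natCast n
      exact Or.inr ⟨⟨n + 1, by omega⟩, Or.inr (by omega)⟩
  · filter_upwards [Ioo_mem_nhds h1 h2] with y hy
    exact (ZZN.ext ((cell_of_between' n hy.1 hy.2).trans (cell_of_between' n h1 h2).symm)).le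

theorem eq_of_le_odd {y z : ZZN} (h : y ≤ z) (hz : Odd z.num) : y = z := by
  rcases h with rfl | ⟨hy, h⟩
  · rfl
  · rw [Nat.odd_iff] at *
    omega

theorem eq_of_le_even {y z : ZZN} (h : y ≤ z) (hy : ¬ Odd y.num) : y = z := by
  rcases h with rfl | ⟨hy', -⟩
  · rfl
  · exact absurd hy' hy

theorem eventually_cell_eq {x : ℝ} (h : Odd (cell x).num) :
    ∀ᶠ y in nhds x, cell y = cell x :=
  (eventually_cell_le x).mono fun _ hy => eq_of_le_odd hy h

/-- The open star of a stratum: the union of the strata whose closure contains it. -/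
noncomputable def star (z : ZZN) : Opens (TopCat.of ℝ) where
  carrier := {x | cell x ≤ z}
  is_open' := isOpen_iff_mem_nhds.2 fun x (hx : cell x ≤ z) =>
    (eventually_cell_le x).mono fun _ hy => hy.trans hx

theorem mem_star {z : ZZN} {x : ℝ} : x ∈ star z ↔ cell x ≤ z := Iff.rfl

theorem star_mono : Monotone star := fun _ _ h _ hx => le_trans (mem_star.1 hx) h

theorem ordConnected_star (z : ZZN) : (star z : Set ℝ).OrdConnected := by
  have key : (star z : Set ℝ) = (ZZN.num ∘ cell) ⁻¹'
      (if Odd z.num then Set.Icc z.num z.num else Set.Icc (z.num - 1) (z.num + 1)) := by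
    refine Set.ext fun x => (mem_star (x := x)).trans ?_
    have hp := z.pos
    split_ifs with h
    · refine ⟨fun hx => ?_, fun hx => (ZZN.ext (le_antisymm hx.2 hx.1)).le⟩
      rw [← eq_of_le_odd hx h]
      exact ⟨le_rfl, le_rfl⟩
    · rw [Nat.not_odd_iff] at h
      rw [Set.mem_preimage, Function.comp_apply, Set.mem_Icc, le_iff, Nat.odd_iff, ZZN.ext_iff]
      omega
  rw [key]
  split_ifs <;> exact Set.ordConnected_Icc.preimage_mono cell_num_mono

/-- `J` is an open interval contained in the open star of the stratum `z` that meets `z`. -/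
structure IsBasic (J : Opens (TopCat.of ℝ)) (z : ZZN) : Prop where
  ordConnected : (J : Set ℝ).OrdConnected
  le_star : J ≤ star z
  exists_mem : ∃ x ∈ J, cell x = z

theorem isBasic_star (z : ZZN) : IsBasic (star z) z :=
  ⟨ordConnected_star z, le_rfl, z.toReal, (cell_toReal z).le, cell_toReal z⟩

theorem IsBasic.le_of_le {J K : Opens (TopCat.of ℝ)} {z w : ZZN} (hJ : IsBasic J z)
    (hK : IsBasic K w) (h : J ≤ K) : z ≤ w := by
  obtain ⟨x, hx, rfl⟩ := hJ.exists_mem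
  exact hK.le_star (h hx)

theorem exists_ordConnected_nhd {U : Opens (TopCat.of ℝ)} {x : ℝ} (hx : x ∈ U) :
    ∃ J : Opens (TopCat.of ℝ), (J : Set ℝ).OrdConnected ∧ x ∈ J ∧ J ≤ U := by
  obtain ⟨ε, hε, h⟩ := Metric.isOpen_iff.1 U.2 x hx
  rw [Real.ball_eq_Ioo] at h
  exact ⟨⟨Set.Ioo (x - ε) (x + ε), isOpen_Ioo⟩, Set.ordConnected_Ioo,
    ⟨by linarith, by linarith⟩, h⟩

/-- The intervals around `x` in the star of its stratum form a neighbourhood basis. -/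
theorem exists_isBasic {U : Opens (TopCat.of ℝ)} {x : ℝ} (hx : x ∈ U) :
    ∃ J, IsBasic J (cell x) ∧ x ∈ J ∧ J ≤ U := by
  obtain ⟨J, h1, h2, h3⟩ :=
    exists_ordConnected_nhd (U := U ⊓ star (cell x)) ⟨hx, mem_star.2 le_rfl⟩
  exact ⟨J, ⟨h1, h3.trans inf_le_right, x, h2, rfl⟩, h2, h3.trans inf_le_left⟩

/-- An interval `J` of the star of a stratum `z` is swept out from a point of `z`: a property
that spreads to neighbouring points, and also back to every point of an open stratum, holds
on all of `J` if it holds at a point of `z`. The two conditions say that the set of points with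
the property is open and closed; closedness needs no check at a point of `natSet`, since the
only such point that `J` can contain is the starting point. -/
theorem IsBasic.induction {J : Opens (TopCat.of ℝ)} {z : ZZN} (hJ : IsBasic J z) (p : ℝ → Prop)
    {x₀ : ℝ} (hx₀ : x₀ ∈ J) (hz : cell x₀ = z) (h₀ : p x₀)
    (hopen : ∀ x ∈ J, p x → ∀ᶠ y in nhds x, p y)
    (hclosed : ∀ x ∈ J, Odd (cell x).num → ∀ᶠ y in nhds x, p y → p x)
    {x : ℝ} (hx : x ∈ J) : p x := by
  by_contra hpx
  have hJo : IsOpen (J : Set ℝ) := J.2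
  have hc : _root_.IsPreconnected (J : Set ℝ) := hJ.ordConnected.isPreconnected
  have h1 : IsOpen {y | y ∈ J ∧ p y} := by
    refine isOpen_iff_mem_nhds.2 fun y hy => ?_
    filter_upwards [hJo.mem_nhds hy.1, hopen y hy.1 hy.2] with w h1 h2
    exact ⟨h1, h2⟩
  have h2 : IsOpen {y | y ∈ J ∧ ¬ p y} := by
    refine isOpen_iff_mem_nhds.2 fun y hy => ?_
    by_cases ho : Odd (cell y).num
    · filter_upwards [hJo.mem_nhds hy.1, hclosed y hy.1 ho] with w h1 h2
      exact ⟨h1, fun h => hy.2 (h2 h)⟩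
    · have h1 : cell y = z := eq_of_le_even (hJ.le_star hy.1) ho
      have h2 : y = x₀ := eq_of_cell_eq_of_even (h1.trans hz.symm) ho
      exact absurd (h2 ▸ h₀) hy.2
  obtain ⟨y, -, hy1, hy2⟩ := hc _ _ h1 h2 (fun y hy => (em (p y)).imp (⟨hy, ·⟩) (⟨hy, ·⟩))
    ⟨x₀, hx₀, hx₀, h₀⟩ ⟨x, hx, hx, hpx⟩
  exact hy2.2 hy1.2

/-! ### The strata and their closure relations -/

theorem mem_natSet_iff {x : ℝ} : x ∈ natSet ↔ ¬ Odd (cell x).num := by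
  constructor
  · rintro ⟨n, hn, rfl⟩
    obtain ⟨m, rfl⟩ : ∃ m, n = m + 1 := ⟨n - 1, by omega⟩
    have := cell_natCast m
    push_cast
    rw [this, Nat.not_odd_iff]
    omega
  · intro h
    rw [Nat.not_odd_iff] at h
    have h2 := eq_of_even_cell (x := x) (by rwa [Nat.not_odd_iff])
    have := (cell x).pos
    refine ⟨(cell x).num / 2, by omega, ?_⟩
    rw [Nat.cast_div (Nat.dvd_of_mod_eq_zero h) (by norm_num)]
    exact_mod_cast h2

/-- Two points lie in the same stratum if and only if they have the same index. -/
theorem map_eq_map_iff {x y : ℝ} :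
    Ambient.map natNative x = Ambient.map natNative y ↔ cell x = cell y := by
  by_cases hx : x ∈ natSet <;> by_cases hy : y ∈ natSet
  · simp only [Ambient.map, hx, hy, dite_true, natNative, Ambient.stratum.injEq,
      NatPoint.mk.injEq, Subtype.mk.injEq]
    exact ⟨fun h => h ▸ rfl, fun h => eq_of_cell_eq_of_even h (mem_natSet_iff.1 hx)⟩
  · simp only [Ambient.map, hx, hy, dite_true, dite_false, reduceCtorEq, false_iff]
    exact fun h => hy (mem_natSet_iff.2 (h ▸ mem_natSet_iff.1 hx))
  · simp only [Ambient.map, hx, hy, dite_true, dite_false, reduceCtorEq, false_iff]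
    exact fun h => hx (mem_natSet_iff.2 (h ▸ mem_natSet_iff.1 hy))
  · simp only [Ambient.map, hx, hy, dite_false, Ambient.component.injEq]
    rw [ConnectedComponents.coe_eq_coe']
    have hxo : Odd (cell x).num := by rwa [mem_natSet_iff, not_not] at hx
    have hyo : Odd (cell y).num := by rwa [mem_natSet_iff, not_not] at hy
    constructor
    · intro h
      have hcont : IsLocallyConstant fun t : ↥natSetᶜ => cell t := by
        refine IsLocallyConstant.iff_eventually_eq _ |>.2 fun t => ?_
        have ht : Odd (cell t).num := by
          have := t.2; rwa [Set.mem_compl_iff, mem_natSet_iff, not_not] at this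
        exact continuous_subtype_val.continuousAt.eventually (eventually_cell_eq ht)
      exact hcont.apply_eq_of_isPreconnected isPreconnected_connectedComponent h
        mem_connectedComponent
    · intro h
      have hc : _root_.IsPreconnected (star (cell y) : Set ℝ) := (ordConnected_star _).isPreconnected
      have hsub : (star (cell y) : Set ℝ) ⊆ natSetᶜ := fun t ht => by
        rw [Set.mem_compl_iff, mem_natSet_iff, not_not, eq_of_le_odd (mem_star.1 ht) hyo]
        exact hyo
      have hc' : _root_.IsPreconnected (Subtype.val ⁻¹' (star (cell y) : Set ℝ) : Set ↥natSetᶜ) := by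
        rw [← Topology.IsInducing.subtypeVal.isPreconnected_image]
        rwa [Set.image_preimage_eq_inter_range, Subtype.range_coe, Set.inter_eq_left.2 hsub]
      exact hc'.subset_connectedComponent (x := ⟨y, hy⟩) (mem_star.2 le_rfl)
        (show (⟨x, hx⟩ : ↥natSetᶜ) ∈ _ from mem_star.2 h.le)

theorem stratum_map (x : ℝ) :
    realStrat.stratum (Ambient.map natNative x) = {y | cell y = cell x} :=
  Set.ext fun _ => map_eq_map_iff

/-- A neighbourhood of a positive integer meets both adjacent intervals. -/
theorem toReal_mem_closure {z w : ZZN} (h : z ≤ w) : w.toReal ∈ closure {y | cell y = z} := by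
  rcases h with rfl | ⟨hz, h⟩
  · exact subset_closure (cell_toReal z)
  obtain ⟨a, ha⟩ := z
  obtain ⟨b, hb⟩ := w
  simp only at hz h
  obtain ⟨m, rfl⟩ := hz
  rcases h with rfl | h
  · have h1 : (⟨2 * m + 1 + 1, hb⟩ : ZZN).toReal = (m : ℝ) + 1 := by
      simp only [toReal]; push_cast; ring
    rw [h1]
    have h2 : (m : ℝ) + 1 ∈ closure (Set.Ioo (m : ℝ) (m + 1)) := by
      rw [closure_Ioo (by linarith)]; exact ⟨by linarith, le_rfl⟩
    exact closure_mono (fun y hy => ZZN.ext (cell_of_between m hy.1 hy.2)) h2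
  · obtain rfl : b = 2 * m := by omega
    have h1 : (⟨2 * m, hb⟩ : ZZN).toReal = (m : ℝ) := by
      simp only [toReal]; push_cast; ring
    rw [h1]
    have h2 : (m : ℝ) ∈ closure (Set.Ioo (m : ℝ) (m + 1)) := by
      rw [closure_Ioo (by linarith)]; exact ⟨le_rfl, by linarith⟩
    exact closure_mono (fun y hy => ZZN.ext (cell_of_between m hy.1 hy.2)) h2

theorem cell_subset_closure_iff {z w : ZZN} :
    {y | cell y = w} ⊆ closure {y | cell y = z} ↔ z ≤ w := by
  constructor
  · intro h
    obtain ⟨y, h1, h2⟩ := mem_closure_iff.1 (h (cell_toReal w)) (star w) (star w).2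
      (mem_star.2 (cell_toReal w).le)
    exact (show cell y = z from h2) ▸ mem_star.1 h1
  · intro h
    by_cases hw : Odd w.num
    · rw [eq_of_le_odd h hw]; exact subset_closure
    · intro y hy
      have hy' : cell y = w := hy
      subst hy'
      rw [eq_of_even_cell hw]
      exact toReal_mem_closure h

/-- The half-integers are isomorphic to the entrance path category of the real line. -/
noncomputable def entIso : ZZN ≃o realStrat.Ent where
  toFun z := realStrat.entOf z.toReal
  invFun σ := cell σ.nonempty.some
  left_inv z := by
    have h := (realStrat.entOf z.toReal).nonempty.some_mem
    exact (map_eq_map_iff.1 h).trans (cell_toReal z)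
  right_inv σ := by
    have h : Ambient.map natNative σ.nonempty.some = σ.index := σ.nonempty.some_mem
    exact Stratification.Ent.ext ((map_eq_map_iff.2 (cell_toReal _)).trans h)
  map_rel_iff' {z w} := by
    change realStrat.stratum (Ambient.map natNative _) ⊆
      closure (realStrat.stratum (Ambient.map natNative _)) ↔ _
    rw [stratum_map, stratum_map, cell_toReal, cell_toReal]
    exact cell_subset_closure_iff

end ZZN

/-! ### The localization of marked zig-zag modules -/

namespace ZZMod

variable {C : Type u} [Category.{v} C]

theorem hom_ext {X Y : ZZMod C} {f g : X ⟶ Y} (h : Hom.base f = Hom.base g)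
    (h' : ∀ p, (Hom.trans f).app p ≫ Y.rep.map (homOfLE (by rw [h])) = (Hom.trans g).app p) :
    f = g := by
  obtain ⟨b, s⟩ := f
  obtain ⟨b', t⟩ := g
  obtain rfl : b = b' := h
  refine Hom.ext rfl (heq_of_eq ?_)
  ext p
  rw [← h' p]
  exact ((congrArg (s.app p ≫ ·) (Y.rep.map_id _)).trans (Category.comp_id _)).symm

theorem map_comp_map_eq_id {P : Type*} [Preorder P] (F : P ⥤ C) {x y : P} (f : x ⟶ y)
    (g : y ⟶ x) : F.map f ≫ F.map g = 𝟙 _ := by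
  rw [← F.map_comp, ← F.map_id]
  rfl

variable (C) in
/-- A representation of the poset of half-integers, marked by the identity. -/
def unmarked : (ZZN ⥤ C) ⥤ ZZMod C where
  obj ρ := ⟨Under.mk (𝟙 ZZN.asPosetI), ρ⟩
  map {ρ η} φ := ⟨𝟙 _, { app := fun p => φ.app p, naturality := fun _ _ f => φ.naturality f }⟩
  map_id ρ := Hom.ext rfl (heq_of_eq rfl)
  map_comp {ρ η θ} φ ψ := by
    refine hom_ext (Category.comp_id _).symm fun p => ?_
    exact (congrArg _ (θ.map_id p)).trans (Category.comp_id _)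

theorem unmarked_comp_pullback : unmarked C ⋙ pullback C = 𝟭 _ := by
  refine CategoryTheory.Functor.ext (fun ρ => rfl) fun ρ η φ => ?_
  refine Eq.trans ?_ ((Category.id_comp _).trans (Category.comp_id _)).symm
  ext z
  exact (congrArg (φ.app z ≫ ·) (η.map_id z)).trans (Category.comp_id _)

/-- The morphism `(id, q^* ρ) ⟶ (q, ρ)` given by `q` itself; it is a weak equivalence. -/
def fromUnmarked : pullback C ⋙ unmarked C ⟶ 𝟭 (ZZMod C) where
  app X := ⟨Under.homMk X.base.hom (Category.id_comp _),
    { app := fun p => 𝟙 _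
      naturality := fun _ _ f => (Category.comp_id _).trans (Category.id_comp _).symm }⟩
  naturality X Y f := by
    refine hom_ext ?_ fun p => ?_
    · ext1
      exact (Category.id_comp _).trans (Under.w (Hom.base f)).symm
    · change (((Hom.trans f).app _ ≫ Y.rep.map _) ≫ 𝟙 _) ≫ Y.rep.map _ = 𝟙 _ ≫ (Hom.trans f).app _
      rw [Category.comp_id, Category.id_comp, Category.assoc]
      exact (congrArg (_ ≫ ·) (map_comp_map_eq_id Y.rep _ _)).trans (Category.comp_id _)

theorem weakEquivalences_fromUnmarked (X : ZZMod C) :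
    weakEquivalences C (fromUnmarked.app X) := by
  change IsIso (Hom.trans (fromUnmarked.app X))
  have : ∀ p, IsIso ((Hom.trans (fromUnmarked.app X)).app p) := fun p =>
    inferInstanceAs (IsIso (𝟙 _))
  exact NatIso.isIso_of_isIso_app _

theorem isInvertedBy_pullback : (weakEquivalences C).IsInvertedBy (pullback C) := by
  intro X Y f hf
  have : IsIso (Hom.trans f) := hf
  have : ∀ z, IsIso (((pullback C).map f).app z) := fun z => by
    have : IsIso (homOfLE (Hom.w f z).le) := ⟨homOfLE (Hom.w f z).ge, rfl, rfl⟩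
    change IsIso ((Hom.trans f).app _ ≫ Y.rep.map (homOfLE (Hom.w f z).le))
    infer_instance
  exact NatIso.isIso_of_isIso_app _

variable (C) in
/-- Every marked module is weakly equivalent to the unmarked module that it pulls back to, so
that inverting the weak equivalences turns the pullback functor into an inverse of the functor
that adds the trivial marking. -/
theorem isEquivalence_lift_pullback :
    ∃ h : (weakEquivalences C).IsInvertedBy (pullback C),
      (Localization.Construction.lift (pullback C) h).IsEquivalence ∧
      ∃ Ψ : (ZZN ⥤ C) ⥤ (weakEquivalences C).Localization,
        Ψ ⋙ Localization.Construction.lift (pullback C) h = 𝟭 _ := by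
  have h := isInvertedBy_pullback (C := C)
  let Q := (weakEquivalences C).Q
  have fac : Q ⋙ Localization.Construction.lift (pullback C) h = pullback C :=
    Localization.Construction.fac _ _
  have hs : (unmarked C ⋙ Q) ⋙ Localization.Construction.lift (pullback C) h = 𝟭 _ := by
    rw [Functor.assoc, fac, unmarked_comp_pullback]
  refine ⟨h, ?_, unmarked C ⋙ Q, hs⟩
  have : IsIso (Functor.whiskerRight (fromUnmarked (C := C)) Q) := by
    have : ∀ X, IsIso ((Functor.whiskerRight (fromUnmarked (C := C)) Q).app X) := fun X =>
      (weakEquivalences C).Q_inverts _ (weakEquivalences_fromUnmarked X)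
    exact NatIso.isIso_of_isIso_app _
  let e : pullback C ⋙ unmarked C ⋙ Q ≅ Q := asIso (Functor.whiskerRight fromUnmarked Q)
  let W := weakEquivalences C
  let L := Localization.Construction.lift (pullback C) h
  have : Localization.Lifting Q W (pullback C ⋙ unmarked C ⋙ Q) (L ⋙ unmarked C ⋙ Q) :=
    ⟨eqToIso (by rw [← Functor.assoc, fac])⟩
  have : Localization.Lifting Q W Q (𝟭 _) := ⟨Functor.rightUnitor _⟩
  let e' : 𝟭 _ ≅ L ⋙ unmarked C ⋙ Q := Localization.liftNatIso Q W _ _ _ _ e.symm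
  exact (CategoryTheory.Equivalence.mk L (unmarked C ⋙ Q) e' (eqToIso hs)).isEquivalence_functor

end ZZMod

/-! ### Cosheaves in terms of maps to test objects -/

section MapLE

variable {C : Type u} [Category.{v} C] {P : Type*} [Preorder P]

/-- The map that a functor on a preorder attaches to an inequality. -/
def mapLE (F : P ⥤ C) {a b : P} (h : a ≤ b) : F.obj a ⟶ F.obj b := F.map (homOfLE h)

theorem mapLE_self (F : P ⥤ C) {a : P} (h : a ≤ a) : mapLE F h = 𝟙 _ := F.map_id a

theorem mapLE_comp (F : P ⥤ C) {a b c : P} (h : a ≤ b) (h' : b ≤ c) :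
    mapLE F h ≫ mapLE F h' = mapLE F (h.trans h') := (F.map_comp _ _).symm

theorem mapLE_comp_assoc (F : P ⥤ C) {a b c : P} (h : a ≤ b) (h' : b ≤ c) {T : C}
    (f : F.obj c ⟶ T) : mapLE F h ≫ mapLE F h' ≫ f = mapLE F (h.trans h') ≫ f := by
  rw [← Category.assoc, mapLE_comp]

theorem mapLE_naturality {F G : P ⥤ C} (α : F ⟶ G) {a b : P} (h : a ≤ b) :
    mapLE F h ≫ α.app b = α.app a ≫ mapLE G h := α.naturality _

theorem isIso_mapLE_of_eq (F : P ⥤ C) {a b : P} (h : a = b) : IsIso (mapLE F h.le) := by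
  subst h
  rw [mapLE_self]
  infer_instance

theorem isIso_mapLE_of_iso {F G : P ⥤ C} (φ : F ≅ G) {a b : P} (h : a ≤ b)
    [IsIso (mapLE F h)] : IsIso (mapLE G h) := by
  have e : mapLE G h = φ.inv.app a ≫ mapLE F h ≫ φ.hom.app b := by
    rw [mapLE_naturality, ← Category.assoc, Iso.inv_hom_id_app, Category.id_comp]
  rw [e]
  infer_instance

/-- A natural transformation of functors on a preorder, given by its components. -/
def natTransOfLE {F G : P ⥤ C} (app : ∀ a, F.obj a ⟶ G.obj a)
    (h : ∀ {a b : P} (h : a ≤ b), mapLE F h ≫ app b = app a ≫ mapLE G h) : F ⟶ G where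
  app := app
  naturality _ _ f := h f.le

end MapLE

namespace Cosheaf

variable {C : Type u} [Category.{v} C] {X : TopCat.{0}}

/-- The maps out of `F` satisfy descent: a map `F W ⟶ T` is the same as a family of maps
`F (U i) ⟶ T` on an open cover of `W` that agree on the intersections. -/
def HasDescent (F : Opens X ⥤ C) : Prop :=
  ∀ ⦃ι : Type⦄ (U : ι → Opens X) (W : Opens X) (hU : ∀ i, U i ≤ W) (_ : ∀ x ∈ W, ∃ i, x ∈ U i)
    (T : C) (t : ∀ i, F.obj (U i) ⟶ T),
    (∀ i j, mapLE F (inf_le_left : U i ⊓ U j ≤ U i) ≫ t i =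
      mapLE F (inf_le_right : U i ⊓ U j ≤ U j) ≫ t j) →
    ∃! f : F.obj W ⟶ T, ∀ i, mapLE F (hU i) ≫ f = t i

section

variable [HasColimitsOfSize.{0, 0} C]

theorem isCosheaf_iff_hasDescent {F : Opens X ⥤ C} : IsCosheaf F ↔ HasDescent F := by
  constructor
  · intro h ι U W hU hW T t ht
    obtain rfl : W = iSup U := le_antisymm
      (fun x hx => Opens.mem_iSup.2 (hW x hx)) (iSup_le hU)
    obtain ⟨hc⟩ := h ι U
    have hk : Sigma.desc (fun p : ι × ι => F.map (Opens.infLELeft (U p.1) (U p.2)) ≫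
        Sigma.ι (fun i => F.obj (U i)) p.1) ≫ Sigma.desc t =
        Sigma.desc (fun p : ι × ι => F.map (Opens.infLERight (U p.1) (U p.2)) ≫
        Sigma.ι (fun i => F.obj (U i)) p.2) ≫ Sigma.desc t := by
      ext p
      simp only [colimit.ι_desc_assoc, Cofan.mk_ι_app, Category.assoc, colimit.ι_desc]
      exact ht p.1 p.2
    obtain ⟨f, hf, huniq⟩ := Cofork.IsColimit.existsUnique hc (Sigma.desc t) hk
    refine ⟨f, fun i => ?_, fun g hg => huniq g ?_⟩
    · have := congrArg (Sigma.ι (fun i => F.obj (U i)) i ≫ ·) hf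
      simp only [Cofork.π_ofπ, colimit.ι_desc_assoc, Cofan.mk_ι_app, colimit.ι_desc] at this
      exact this
    · refine Sigma.hom_ext _ _ fun i => ?_
      simp only [Cofork.π_ofπ, colimit.ι_desc_assoc, Cofan.mk_ι_app, colimit.ι_desc]
      exact hg i
  · intro h ι U
    have key : ∀ s : Cofork
        (Sigma.desc fun p : ι × ι => F.map (Opens.infLELeft (U p.1) (U p.2)) ≫
          Sigma.ι (fun i => F.obj (U i)) p.1)
        (Sigma.desc fun p : ι × ι => F.map (Opens.infLERight (U p.1) (U p.2)) ≫
          Sigma.ι (fun i => F.obj (U i)) p.2),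
        ∃! f : F.obj (iSup U) ⟶ s.pt, ∀ i, mapLE F (le_iSup U i) ≫ f =
          Sigma.ι (fun i => F.obj (U i)) i ≫ s.π := by
      intro s
      refine h U _ (le_iSup U) (fun x hx => Opens.mem_iSup.1 hx) s.pt _ fun i j => ?_
      have := congrArg
        (Sigma.ι (fun p : ι × ι => F.obj (U p.1 ⊓ U p.2)) (i, j) ≫ ·) s.condition
      simp only [colimit.ι_desc_assoc, Cofan.mk_ι_app, Category.assoc] at this
      exact this
    choose d hd huniq using key
    refine ⟨Cofork.IsColimit.mk _ d (fun s => ?_) fun s m hm => ?_⟩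
    · refine Sigma.hom_ext _ _ fun i => ?_
      simp only [Cofork.π_ofπ, colimit.ι_desc_assoc, Cofan.mk_ι_app]
      exact hd s i
    · refine huniq s m fun i => ?_
      rw [← hm]
      simp only [Cofork.π_ofπ, colimit.ι_desc_assoc, Cofan.mk_ι_app]
      rfl

end

namespace HasDescent

variable {F : Opens X ⥤ C} (hF : HasDescent F)

include hF

/-- Two maps out of `F W` agree if they agree near every point of `W`. -/
theorem hom_ext {W : Opens X} {T : C} {f g : F.obj W ⟶ T}
    (h : ∀ x ∈ W, ∃ (J : Opens X) (hJ : J ≤ W), x ∈ J ∧ mapLE F hJ ≫ f = mapLE F hJ ≫ g) :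
    f = g := by
  let ι := {J : Opens X // ∃ hJ : J ≤ W, mapLE F hJ ≫ f = mapLE F hJ ≫ g}
  obtain ⟨m, -, hm⟩ := hF (ι := ι) (fun J => J.1) W (fun J => J.2.1)
    (fun x hx => by
      obtain ⟨J, hJ, hx, h⟩ := h x hx
      exact ⟨⟨J, hJ, h⟩, hx⟩) T (fun J => mapLE F J.2.1 ≫ f)
    (fun J K => by rw [mapLE_comp_assoc, mapLE_comp_assoc])
  exact (hm f fun _ => rfl).trans (hm g fun J => J.2.2.symm).symm

/-- A family of maps on a cover glues if it agrees near every point of every intersection. -/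
theorem glue {ι : Type} (U : ι → Opens X) {W : Opens X} (hU : ∀ i, U i ≤ W)
    (hW : ∀ x ∈ W, ∃ i, x ∈ U i) {T : C} (t : ∀ i, F.obj (U i) ⟶ T)
    (ht : ∀ i j, ∀ x, x ∈ U i → x ∈ U j → ∃ (J : Opens X) (h₁ : J ≤ U i) (h₂ : J ≤ U j),
      x ∈ J ∧ mapLE F h₁ ≫ t i = mapLE F h₂ ≫ t j) :
    ∃ f : F.obj W ⟶ T, ∀ i, mapLE F (hU i) ≫ f = t i := by
  refine (hF U W hU hW T t fun i j => hF.hom_ext fun x hx => ?_).exists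
  obtain ⟨J, h₁, h₂, hxJ, h⟩ := ht i j x hx.1 hx.2
  exact ⟨J, le_inf h₁ h₂, hxJ, by rwa [mapLE_comp_assoc, mapLE_comp_assoc]⟩

/-- The value of a cosheaf on the empty set is an initial object. -/
theorem nonempty_isInitial_bot : Nonempty (IsInitial (F.obj ⊥)) := by
  have h : ∀ T : C, ∃! f : F.obj ⊥ ⟶ T, ∀ i : Empty, mapLE F (i.elim : (⊥ : Opens X) ≤ ⊥) ≫ f =
      i.elim := fun T => hF (ι := Empty) (fun _ => ⊥) ⊥ _ (fun x hx => hx.elim) T _ (fun i => i.elim)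
  have hu : ∀ T : C, Nonempty (Unique (F.obj ⊥ ⟶ T)) := fun T => by
    obtain ⟨f, -, hf⟩ := h T
    exact ⟨⟨⟨f⟩, fun g => hf g fun i => i.elim⟩⟩
  exact ⟨IsInitial.ofUnique _ (h := fun T => (hu T).some)⟩

end HasDescent

end Cosheaf

/-! ### Restriction to open subsets -/

namespace Cosheaf

variable {C : Type u} [Category.{v} C] {X Y : TopCat.{0}}

/-- The image of an open set under an open map, as an open set whose preimage contains it. -/
def image {f : X ⟶ Y} (hf : IsOpenMap f) (U : Opens X) : StructuredArrow U (Opens.map f) :=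
  StructuredArrow.mk (Y := hf.functor.obj U) (hf.adjunction.unit.app U)

/-- The image is the smallest open set whose preimage contains the given open set. -/
def isInitialImage {f : X ⟶ Y} (hf : IsOpenMap f) (U : Opens X) : IsInitial (image hf U) :=
  IsInitial.ofUniqueHom
    (fun A => StructuredArrow.homMk ((hf.adjunction.homEquiv U A.right).symm A.hom) rfl)
    (fun _ _ => StructuredArrow.hom_ext _ _ rfl)

section

variable [HasLimitsOfSize.{0, 0} C]

/-- The pullback along an open map is evaluation on images: the image of `U` is the smallest of
the open sets over which the limit is taken. -/
noncomputable def pullbackIso {f : X ⟶ Y} (hf : IsOpenMap f) (F : Opens Y ⥤ C) :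
    pullback f F ≅ hf.functor ⋙ F :=
  NatIso.ofComponents
    (fun U =>
      @asIso _ _ ((pullback f F).obj U) ((hf.functor ⋙ F).obj U)
        (limit.π (StructuredArrow.proj U (Opens.map f) ⋙ F) (image hf U))
        (isIso_π_of_isInitial (isInitialImage hf U) _))
    (fun {U V} i => by
      refine (limit.lift_π _ _).trans ?_
      exact (limit.w (StructuredArrow.proj U (Opens.map f) ⋙ F)
        (StructuredArrow.homMk (hf.functor.map i) rfl :
          image hf U ⟶ (StructuredArrow.map i).obj (image hf V))).symm)

end

/-- The restriction of a cosheaf to an open subset is a cosheaf. -/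
theorem HasDescent.comp_functor {f : X ⟶ Y} (hf : Topology.IsOpenEmbedding f) {F : Opens Y ⥤ C}
    (hF : HasDescent F) : HasDescent (hf.isOpenMap.functor ⋙ F) := by
  intro ι U W hU hW T t ht
  have hU' : ∀ i, hf.isOpenMap.functor.obj (U i) ≤ hf.isOpenMap.functor.obj W :=
    fun i => Set.image_mono (hU i)
  have hW' : ∀ y ∈ hf.isOpenMap.functor.obj W, ∃ i, y ∈ hf.isOpenMap.functor.obj (U i) := by
    rintro _ ⟨x, hx, rfl⟩
    obtain ⟨i, hi⟩ := hW x hx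
    exact ⟨i, x, hi, rfl⟩
  obtain ⟨g, hg⟩ := hF.glue _ hU' hW' t fun i j y hyi hyj => by
    obtain ⟨x, hx, rfl⟩ := hyi
    obtain ⟨x', hx', h⟩ := hyj
    obtain rfl := hf.injective h
    exact ⟨hf.isOpenMap.functor.obj (U i ⊓ U j), Set.image_mono inf_le_left,
      Set.image_mono inf_le_right, ⟨x', ⟨hx, hx'⟩, rfl⟩, ht i j⟩
  refine ⟨g, hg, fun g' hg' => hF.hom_ext fun y hy => ?_⟩
  obtain ⟨i, hi⟩ := hW' y hy
  exact ⟨_, hU' i, hi, (hg' i).trans (hg i).symm⟩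

/-- On a space with at most one point, descent only says that the empty set has an initial
value. -/
theorem hasDescent_of_subsingleton [Subsingleton X] {F : Opens X ⥤ C}
    (hF : IsInitial (F.obj ⊥)) : HasDescent F := by
  intro ι U W hU hW T t ht
  by_cases hne : ∃ x, x ∈ W
  · obtain ⟨x, hx⟩ := hne
    obtain ⟨i, hi⟩ := hW x hx
    have hi : U i = W := le_antisymm (hU i) fun y _ => Subsingleton.elim x y ▸ hi
    have := isIso_mapLE_of_eq F hi
    refine ⟨inv (mapLE F hi.le) ≫ t i, fun j => ?_, fun g hg => ?_⟩
    · have hj : U j ⊓ U i = U j := inf_eq_left.2 ((hU j).trans hi.ge)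
      have := isIso_mapLE_of_eq F hj
      rw [← cancel_epi (mapLE F hj.le), mapLE_comp_assoc]
      refine Eq.trans ?_ (ht j i).symm
      rw [← mapLE_comp_assoc F (inf_le_right : U j ⊓ U i ≤ U i) hi.le, IsIso.hom_inv_id_assoc]
    · rw [← hg i, IsIso.inv_hom_id_assoc]
  · have hW : W = ⊥ := le_bot_iff.1 fun x hx => hne ⟨x, hx⟩
    subst hW
    refine ⟨hF.to T, fun j => ?_, fun g _ => hF.hom_ext _ _⟩
    have := isIso_mapLE_of_eq F (le_bot_iff.1 (hU j))
    rw [← cancel_epi (inv (mapLE F (le_bot_iff.1 (hU j)).le))]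
    exact hF.hom_ext _ _

/-! ### Constant cosheaves -/

section Components

variable [LocallyConnectedSpace X]

/-- A connected component of an open subset of a locally connected space, as an open set. -/
def component (W : Opens X) (c : ConnectedComponents W) : Opens X where
  carrier := Subtype.val '' (ConnectedComponents.mk ⁻¹' {c})
  is_open' := by
    have : LocallyConnectedSpace W := W.2.isOpenEmbedding_subtypeVal.locallyConnectedSpace
    obtain ⟨x, rfl⟩ := ConnectedComponents.surjective_coe c
    rw [connectedComponents_preimage_singleton]
    exact W.2.isOpenMap_subtype_val _ isOpen_connectedComponent

theorem component_le (W : Opens X) (c : ConnectedComponents W) : component W c ≤ W := by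
  rintro _ ⟨x, -, rfl⟩
  exact x.2

theorem mem_component (W : Opens X) (x : W) :
    (x : X) ∈ component W (ConnectedComponents.mk x) := ⟨x, rfl, rfl⟩

theorem eq_of_mem_component {W : Opens X} {c d : ConnectedComponents W} {x : X}
    (h : x ∈ component W c) (h' : x ∈ component W d) : c = d := by
  obtain ⟨y, hy, rfl⟩ := h
  obtain ⟨z, hz, h⟩ := h'
  obtain rfl := Subtype.ext h
  exact Eq.trans (show c = _ from hy.symm) hz

theorem isConnected_component (W : Opens X) (c : ConnectedComponents W) :
    _root_.IsConnected (component W c : Set X) := by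
  obtain ⟨x, rfl⟩ := ConnectedComponents.surjective_coe c
  change _root_.IsConnected (Subtype.val '' (ConnectedComponents.mk ⁻¹' _))
  rw [connectedComponents_preimage_singleton]
  exact isConnected_connectedComponent.image _ continuous_subtype_val.continuousOn

theorem component_le_component {W W' : Opens X} (h : W ⟶ W') (c : ConnectedComponents W) :
    component W c ≤ component W' ((components X).map h c) := by
  rintro _ ⟨x, rfl, rfl⟩
  exact mem_component W' ⟨x, h.le x.2⟩

variable [HasColimitsOfSize.{0, 0} C]

/-- A cosheaf on a locally connected space whose values on connected open sets are compatibly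
isomorphic to a fixed object is constant: an open set is covered by its components, and these
are disjoint. -/
theorem nonempty_iso_constant {F : Opens X ⥤ C} (hF : HasDescent F) {V : C}
    (e : ∀ J : Opens X, _root_.IsConnected (J : Set X) → (F.obj J ≅ V))
    (he : ∀ J K hJ hK, ∀ h : J ≤ K, mapLE F h ≫ (e K hK).hom = (e J hJ).hom) :
    Nonempty (F ≅ constant X V) := by
  have he' : ∀ J K hJ hK, ∀ h : J ≤ K, (e J hJ).inv ≫ mapLE F h = (e K hK).inv := by
    intro J K hJ hK h
    rw [Iso.inv_comp_eq, ← he J K hJ hK h, Category.assoc, Iso.hom_inv_id, Category.comp_id]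
  let α : constant X V ⟶ F :=
    { app := fun W => Sigma.desc fun c => (e _ (isConnected_component W c)).inv ≫
        mapLE F (component_le W c)
      naturality := fun W W' h => by
        refine Sigma.hom_ext _ _ fun c => ?_
        simp only [constant, Functor.comp_obj, Functor.comp_map, sigmaConst, Sigma.ι_comp_map'_assoc,
          colimit.ι_desc, Cofan.mk_ι_app, Category.id_comp, colimit.ι_desc_assoc, Category.assoc]
        rw [← he' _ _ (isConnected_component W c) (isConnected_component W' _)
          (component_le_component h c), Category.assoc, mapLE_comp]
        exact congrArg (_ ≫ ·) (mapLE_comp F (component_le W c) h.le).symm }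
  have hα : ∀ W c {T : C} (t : F.obj W ⟶ T), Sigma.ι (fun _ : ConnectedComponents W => V) c ≫
      (α.app W ≫ t : (∐ fun _ : ConnectedComponents W => V) ⟶ T) =
        (e _ (isConnected_component W c)).inv ≫ mapLE F (component_le W c) ≫ t := fun W c T t =>
    ((Category.assoc _ _ _).symm.trans (congrArg (· ≫ t) (Sigma.ι_desc _ _))).trans
      (Category.assoc _ _ _)
  have : ∀ W, IsIso (α.app W) := fun W => by
    refine isIso_of_coyoneda_map_bijective _ fun T => ⟨fun f g h => ?_, fun t => ?_⟩
    · refine hF.hom_ext fun x hx => ⟨_, component_le W _, mem_component W ⟨x, hx⟩, ?_⟩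
      have h' := congrArg (Sigma.ι (fun _ : ConnectedComponents W => V)
        (ConnectedComponents.mk ⟨x, hx⟩) ≫ ·) h
      exact (cancel_epi _).1 (((hα W _ f).symm.trans h').trans (hα W _ g))
    · obtain ⟨f, hf⟩ := hF.glue (component W) (component_le W)
        (fun x hx => ⟨_, mem_component W ⟨x, hx⟩⟩)
        (fun c => (e _ (isConnected_component W c)).hom ≫ Sigma.ι (fun _ => V) c ≫ t)
        (fun c d x hc hd => by
          obtain rfl := eq_of_mem_component hc hd
          exact ⟨_, le_rfl, le_rfl, hc, rfl⟩)
      refine ⟨f, Sigma.hom_ext _ _ fun c => (hα W c f).trans ?_⟩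
      exact (congrArg (_ ≫ ·) (hf c)).trans (Iso.inv_hom_id_assoc _ _)
  have := NatIso.isIso_of_isIso_app α
  exact ⟨(asIso α).symm⟩

omit [LocallyConnectedSpace X] in
/-- A constant cosheaf has the same value on any two nested connected open sets. -/
theorem isIso_mapLE_constant (V : C) {J K : Opens X} (hJ : _root_.IsConnected (J : Set X))
    (hK : _root_.IsConnected (K : Set X)) (h : J ≤ K) : IsIso (mapLE (constant X V) h) := by
  have : ConnectedSpace J := isConnected_iff_connectedSpace.1 hJ
  have : ConnectedSpace K := isConnected_iff_connectedSpace.1 hK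
  have : IsIso ((components X).map (homOfLE h)) := by
    rw [isIso_iff_bijective]
    refine ⟨fun x y _ => ?_, fun y => ?_⟩
    · exact (inferInstance : Subsingleton (ConnectedComponents J)).elim x y
    · obtain ⟨x⟩ := (inferInstance : Nonempty (ConnectedComponents J))
      exact ⟨x, (inferInstance : Subsingleton (ConnectedComponents K)).elim _ _⟩
  exact inferInstanceAs (IsIso ((sigmaConst.obj V).map ((components X).map (homOfLE h))))

end Components

end Cosheaf

/-! ### Constructible cosheaves on the real line are invariant under shrinking -/

namespace Cosheaf

variable {C : Type u} [Category.{v} C]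

section

variable {X Y Z : TopCat.{0}}

/-- The pullback along two open maps in succession is evaluation on images. -/
noncomputable def pullbackPullbackIso [HasLimitsOfSize.{0, 0} C] {f : X ⟶ Y} {g : Y ⟶ Z}
    (hf : IsOpenMap f) (hg : IsOpenMap g) (hfg : IsOpenMap (f ≫ g)) (F : Opens Z ⥤ C) :
    pullback f (pullback g F) ≅ hfg.functor ⋙ F :=
  pullbackIso hf _ ≪≫ Functor.isoWhiskerLeft hf.functor (pullbackIso hg F) ≪≫
    Functor.isoWhiskerRight (NatIso.ofComponents (F := hf.functor ⋙ hg.functor) (G := hfg.functor)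
      (fun _ => eqToIso (Opens.ext (Set.image_image _ _ _))) (fun _ => Subsingleton.elim _ _)) F

theorem isIso_mapLE_of_iso_constant [HasColimitsOfSize.{0, 0} C] {f : X ⟶ Y}
    (hf : Topology.IsOpenEmbedding f) {F : Opens Y ⥤ C} {V : C}
    (φ : hf.isOpenMap.functor ⋙ F ≅ constant X V) {J K : Opens Y}
    (hJ : _root_.IsConnected (J : Set Y)) (hK : _root_.IsConnected (K : Set Y)) (h : J ≤ K)
    (hr : (K : Set Y) ⊆ Set.range f) : IsIso (mapLE F h) := by
  have key : ∀ L : Opens Y, (L : Set Y) ⊆ Set.range f →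
      hf.isOpenMap.functor.obj ((Opens.map f).obj L) = L := fun L hL =>
    Opens.ext (Set.image_preimage_eq_of_subset hL)
  have conn : ∀ L : Opens Y, (L : Set Y) ⊆ Set.range f → _root_.IsConnected (L : Set Y) →
      _root_.IsConnected ((Opens.map f).obj L : Set X) := by
    intro L hL hc
    have e : f '' ((Opens.map f).obj L : Set X) = L := congrArg SetLike.coe (key L hL)
    refine ⟨Set.image_nonempty.1 (e ▸ hc.nonempty), ?_⟩
    rw [← hf.isInducing.isPreconnected_image, e]
    exact hc.isPreconnected
  have hrJ : (J : Set Y) ⊆ Set.range f := Set.Subset.trans h hr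
  have h' : (Opens.map f).obj J ≤ (Opens.map f).obj K := fun _ hy => h hy
  have := isIso_mapLE_constant V (conn J hrJ hJ) (conn K hr hK) h'
  have h1 : IsIso (mapLE (hf.isOpenMap.functor ⋙ F) h') := isIso_mapLE_of_iso φ.symm h'
  have h2 : IsIso (mapLE F (hf.isOpenMap.functor.monotone h')) := h1
  have h3 := isIso_mapLE_of_eq F (key K hr)
  have h4 := isIso_mapLE_of_eq F (key J hrJ)
  have h5 : mapLE F h = inv (mapLE F (key J hrJ).le) ≫
      mapLE F (hf.isOpenMap.functor.monotone h') ≫ mapLE F (key K hr).le := by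
    rw [IsIso.eq_inv_comp, mapLE_comp, mapLE_comp]
  rw [h5]
  infer_instance

theorem HasDescent.glue₂ {F : Opens X ⥤ C} (hF : HasDescent F) {K L : Opens X} {T : C}
    (s : F.obj K ⟶ T) (t : F.obj L ⟶ T)
    (h : mapLE F (inf_le_left : K ⊓ L ≤ K) ≫ s = mapLE F (inf_le_right : K ⊓ L ≤ L) ≫ t) :
    ∃ f : F.obj (K ⊔ L) ⟶ T, mapLE F le_sup_left ≫ f = s ∧ mapLE F le_sup_right ≫ f = t := by
  obtain ⟨f, hf⟩ := hF.glue (W := K ⊔ L) (fun b : Bool => if b then K else L)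
    (fun b => by cases b <;> simp)
    (fun x hx => hx.elim (fun h => ⟨true, h⟩) (fun h => ⟨false, h⟩))
    (T := T) (fun b => match b with
      | true => s
      | false => t)
    (fun i j x hi hj => by
      cases i <;> cases j
      · exact ⟨L, le_rfl, le_rfl, hi, rfl⟩
      · exact ⟨K ⊓ L, inf_le_right, inf_le_left, ⟨hj, hi⟩, h.symm⟩
      · exact ⟨K ⊓ L, inf_le_left, inf_le_right, ⟨hi, hj⟩, h⟩
      · exact ⟨K, le_rfl, le_rfl, hi, rfl⟩)
  exact ⟨f, hf true, hf false⟩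

end

open ZZN

/-- A precosheaf on the real line does not change when an interval is shrunk without changing the
smallest stratum that it meets. -/
def IsInvariant (F : Opens (TopCat.of ℝ) ⥤ C) : Prop :=
  ∀ ⦃J K : Opens (TopCat.of ℝ)⦄ ⦃z : ZZN⦄, IsBasic J z → IsBasic K z → ∀ h : J ≤ K,
    IsIso (mapLE F h)

theorem _root_.ZZN.IsBasic.of_le_of_le {I J K : Opens (TopCat.of ℝ)} {z : ZZN} (hI : IsBasic I z)
    (hJ : IsBasic J z) (h : I ≤ K) (h' : K ≤ J) (hK : (K : Set ℝ).OrdConnected) : IsBasic K z :=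
  ⟨hK, h'.trans hJ.le_star, hI.exists_mem.imp fun _ hx => ⟨h hx.1, hx.2⟩⟩

/-- Every point outside `natSet` has an interval around it on which `F` is constant. -/
def IsConstantNearOpenStrata (F : Opens (TopCat.of ℝ) ⥤ C) : Prop :=
  ∀ x : ℝ, Odd (cell x).num → ∃ W : Opens (TopCat.of ℝ), (W : Set ℝ).OrdConnected ∧ x ∈ W ∧
    ∀ ⦃I K : Opens (TopCat.of ℝ)⦄, (I : Set ℝ).OrdConnected → (I : Set ℝ).Nonempty →
      (K : Set ℝ).OrdConnected → K ≤ W → ∀ h : I ≤ K, IsIso (mapLE F h)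

variable {F : Opens (TopCat.of ℝ) ⥤ C}

theorem IsConstantNearOpenStrata.hom_ext (hc : IsConstantNearOpenStrata F) (hF : HasDescent F)
    {I J : Opens (TopCat.of ℝ)} {z : ZZN} (hI : IsBasic I z) (hJ : IsBasic J z) (h : I ≤ J)
    {T : C} {f g : F.obj J ⟶ T} (hfg : mapLE F h ≫ f = mapLE F h ≫ g) : f = g := by
  obtain ⟨x₀, hx₀, hz⟩ := hI.exists_mem
  refine hF.hom_ext fun x hx => ?_
  refine hJ.induction
    (fun x => ∃ (K : Opens (TopCat.of ℝ)) (hK : K ≤ J), x ∈ K ∧ mapLE F hK ≫ f = mapLE F hK ≫ g)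
    (h hx₀) hz ⟨I, h, hx₀, hfg⟩ ?_ ?_ hx
  · rintro x - ⟨K, hK, hxK, e⟩
    exact Filter.mem_of_superset (K.2.mem_nhds hxK) fun y hy => ⟨K, hK, hy, e⟩
  · intro x hx ho
    obtain ⟨W, hW, hxW, hWc⟩ := hc x ho
    refine Filter.mem_of_superset (IsOpen.mem_nhds (W ⊓ J).2 (show x ∈ W ⊓ J from ⟨hxW, hx⟩)) ?_
    rintro y hy ⟨K, hK, hyK, e⟩
    obtain ⟨L, hL, hyL, hLW⟩ := exists_ordConnected_nhd (U := (W ⊓ J) ⊓ K) (x := y) ⟨hy, hyK⟩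
    have hLW' : L ≤ W ⊓ J := hLW.trans inf_le_left
    have := hWc hL ⟨y, hyL⟩ (hW.inter hJ.ordConnected) inf_le_left hLW'
    refine ⟨W ⊓ J, inf_le_right, ⟨hxW, hx⟩, (cancel_epi (mapLE F hLW')).1 ?_⟩
    have e' := congrArg (mapLE F (hLW.trans inf_le_right) ≫ ·) e
    simp only [mapLE_comp_assoc] at e' ⊢
    exact e'

/-- Maps out of `F` extend along an interval, one small interval at a time; the extensions are
unique and therefore glue. -/
theorem IsConstantNearOpenStrata.isInvariant (hc : IsConstantNearOpenStrata F)
    (hF : HasDescent F) : IsInvariant F := by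
  intro I J z hI hJ h
  refine isIso_of_coyoneda_map_bijective _ fun T =>
    ⟨fun f g hfg => hc.hom_ext hF hI hJ h hfg, fun t => ?_⟩
  obtain ⟨x₀, hx₀, hz⟩ := hI.exists_mem
  have key : ∀ x ∈ J, ∃ K : Opens (TopCat.of ℝ), (K : Set ℝ).OrdConnected ∧ x ∈ K ∧
      ∃ (h₁ : I ≤ K) (_ : K ≤ J) (s : F.obj K ⟶ T), mapLE F h₁ ≫ s = t := by
    intro x hx
    refine hJ.induction (fun x => ∃ K : Opens (TopCat.of ℝ), (K : Set ℝ).OrdConnected ∧ x ∈ K ∧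
      ∃ (h₁ : I ≤ K) (_ : K ≤ J) (s : F.obj K ⟶ T), mapLE F h₁ ≫ s = t)
      (h hx₀) hz ⟨I, hI.ordConnected, hx₀, le_rfl, h, t, ?_⟩ ?_ ?_ hx
    · rw [mapLE_self, Category.id_comp]
    · rintro x - ⟨K, hK, hxK, e⟩
      exact Filter.mem_of_superset (K.2.mem_nhds hxK) fun y hy => ⟨K, hK, hy, e⟩
    · intro x hx ho
      obtain ⟨W, hW, hxW, hWc⟩ := hc x ho
      refine Filter.mem_of_superset (IsOpen.mem_nhds (W ⊓ J).2 (show x ∈ W ⊓ J from ⟨hxW, hx⟩)) ?_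
      rintro y hy ⟨K, hK, hyK, h₁, h₂, s, e⟩
      have hWJ : ((W ⊓ J : Opens (TopCat.of ℝ)) : Set ℝ).OrdConnected := hW.inter hJ.ordConnected
      have := hWc (I := K ⊓ (W ⊓ J)) (hK.inter hWJ) ⟨y, hyK, hy⟩ hWJ inf_le_left
        (inf_le_right : K ⊓ (W ⊓ J) ≤ W ⊓ J)
      obtain ⟨r, hr, -⟩ := hF.glue₂ s (inv (mapLE F (inf_le_right : K ⊓ (W ⊓ J) ≤ W ⊓ J)) ≫
        mapLE F inf_le_left ≫ s) (by rw [IsIso.hom_inv_id_assoc])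
      refine ⟨K ⊔ (W ⊓ J), ?_, Or.inr ⟨hxW, hx⟩, h₁.trans le_sup_left,
        sup_le h₂ inf_le_right, r, ?_⟩
      · exact (hK.isPreconnected.union y hyK hy hWJ.isPreconnected).ordConnected
      · rw [← mapLE_comp_assoc F h₁ le_sup_left, hr, e]
  choose K hK hxK h₁ h₂ s hs using key
  obtain ⟨f, hf⟩ := hF.glue (fun x : {x // x ∈ J} => K x.1 x.2) (fun x => h₂ x.1 x.2)
    (fun x hx => ⟨⟨x, hx⟩, hxK x hx⟩) (fun x => s x.1 x.2) (fun x y w hw hw' => by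
      have hKK := hI.of_le_of_le hJ (le_inf (h₁ x.1 x.2) (h₁ y.1 y.2))
        (inf_le_left.trans (h₂ x.1 x.2)) ((hK x.1 x.2).inter (hK y.1 y.2))
      refine ⟨K x.1 x.2 ⊓ K y.1 y.2, inf_le_left, inf_le_right, ⟨hw, hw'⟩, ?_⟩
      refine hc.hom_ext hF hI hKK (le_inf (h₁ x.1 x.2) (h₁ y.1 y.2)) ?_
      rw [mapLE_comp_assoc, mapLE_comp_assoc, hs, hs])
  refine ⟨f, ?_⟩
  change mapLE F h ≫ f = t
  rw [← hs x₀ (h hx₀), ← hf ⟨x₀, h hx₀⟩, mapLE_comp_assoc]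

section

variable [HasLimitsOfSize.{0, 0} C] [HasColimitsOfSize.{0, 0} C]

theorem isOpenEmbedding_ofHom_val {X : TopCat.{0}} {A : Set X} (hA : IsOpen A) :
    Topology.IsOpenEmbedding (TopCat.ofHom ⟨Subtype.val, continuous_subtype_val⟩ :
      TopCat.of A ⟶ X) := hA.isOpenEmbedding_subtypeVal

theorem isOpen_stratum {x : ℝ} (h : Odd (cell x).num) :
    IsOpen (realStrat.stratum (Ambient.map natNative x)) := by
  have e : realStrat.stratum (Ambient.map natNative x) = star (cell x) := by
    rw [stratum_map]
    exact Set.ext fun y => ⟨fun hy => mem_star.2 (le_of_eq hy), fun hy => eq_of_le_odd hy h⟩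
  rw [e]
  exact (star (cell x)).2

theorem isConstantNearOpenStrata_of_isConstructible (hF : isConstructible C realStrat F) :
    IsConstantNearOpenStrata F := by
  intro x hx
  obtain ⟨U, hxU, V, ⟨φ⟩⟩ := hF.2 (Ambient.map natNative x) ⟨x, rfl⟩
  have hA := isOpenEmbedding_ofHom_val (X := TopCat.of ℝ) (isOpen_stratum hx)
  have hU := isOpenEmbedding_ofHom_val U.2
  have hUA := hA.comp hU
  obtain ⟨W, hW, hxW, hWU⟩ := exists_ordConnected_nhd
    (U := hA.isOpenMap.functor.obj U) (x := x) ⟨⟨x, rfl⟩, hxU, rfl⟩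
  refine ⟨W, hW, hxW, fun I K hI hIne hK hKW h => ?_⟩
  refine isIso_mapLE_of_iso_constant (f := TopCat.ofHom ⟨Subtype.val, continuous_subtype_val⟩ ≫
    TopCat.ofHom ⟨Subtype.val, continuous_subtype_val⟩) hUA (F := F)
    ((pullbackPullbackIso hU.isOpenMap hA.isOpenMap hUA.isOpenMap F).symm ≪≫ φ)
    ⟨hIne, hI.isPreconnected⟩ ⟨hIne.mono h, hK.isPreconnected⟩ h ?_
  intro y hy
  obtain ⟨w, hw, rfl⟩ := hWU (hKW hy)
  exact ⟨⟨w, hw⟩, rfl⟩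

theorem isInvariant_of_isConstructible (hF : isConstructible C realStrat F) : IsInvariant F :=
  (isConstantNearOpenStrata_of_isConstructible hF).isInvariant
    (isCosheaf_iff_hasDescent.1 hF.1)

end

/-! ### Restriction to the open stars is fully faithful -/

/-- The value on an interval is the value on the open star of the smallest stratum it meets. -/
theorem IsInvariant.isIso_star (hF : IsInvariant F) {J : Opens (TopCat.of ℝ)} {z : ZZN}
    (hJ : IsBasic J z) : IsIso (mapLE F hJ.le_star) := hF hJ (isBasic_star z) _

variable {G : Opens (TopCat.of ℝ) ⥤ C}

theorem hom_ext_star (hF : HasDescent F) (hG : IsInvariant G)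
    {α β : F ⟶ G} (h : ∀ z, α.app (star z) = β.app (star z)) : α = β := by
  ext U
  refine hF.hom_ext fun x hx => ?_
  obtain ⟨J, hJ, hxJ, hJU⟩ := exists_isBasic hx
  refine ⟨J, hJU, hxJ, ?_⟩
  rw [mapLE_naturality, mapLE_naturality]
  have := hG.isIso_star hJ
  congr 1
  rw [← cancel_mono (mapLE G hJ.le_star), ← mapLE_naturality, ← mapLE_naturality, h]

theorem exists_hom_of_star (hF : HasDescent F) (hG : IsInvariant G)
    (τ : ∀ z, F.obj (star z) ⟶ G.obj (star z))
    (hτ : ∀ {z w} (h : z ≤ w), mapLE F (star_mono h) ≫ τ w = τ z ≫ mapLE G (star_mono h)) :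
    ∃ α : F ⟶ G, ∀ z, α.app (star z) = τ z := by
  -- the component on an interval, by transport from the open star
  have hb : ∀ J z, IsBasic J z → ∃ b : F.obj J ⟶ G.obj J,
      ∀ h : J ≤ star z, b ≫ mapLE G h = mapLE F h ≫ τ z := fun J z hJ => by
    have := hG.isIso_star hJ
    exact ⟨mapLE F hJ.le_star ≫ τ z ≫ inv (mapLE G hJ.le_star), fun h => by simp⟩
  choose b hb using hb
  have hbn : ∀ {J K z w} (hJ : IsBasic J z) (hK : IsBasic K w) (h : J ≤ K),
      mapLE F h ≫ b K w hK = b J z hJ ≫ mapLE G h := fun {J K z w} hJ hK h => by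
    have := hG.isIso_star hK
    have hzw := hJ.le_of_le hK h
    rw [← cancel_mono (mapLE G hK.le_star), Category.assoc, hb, mapLE_comp_assoc, Category.assoc,
      mapLE_comp, ← mapLE_comp G hJ.le_star (star_mono hzw), ← Category.assoc,
      hb, Category.assoc, ← hτ hzw, mapLE_comp_assoc]
  have hα : ∀ U, ∃ a : F.obj U ⟶ G.obj U, ∀ J z (hJ : IsBasic J z) (h : J ≤ U),
      mapLE F h ≫ a = b J z hJ ≫ mapLE G h := fun U => by
    obtain ⟨a, ha⟩ := hF.glue
      (fun i : {p : Opens (TopCat.of ℝ) × ZZN // IsBasic p.1 p.2 ∧ p.1 ≤ U} => i.1.1)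
      (fun i => i.2.2)
      (fun x hx => by
        obtain ⟨J, hJ, hxJ, hJU⟩ := exists_isBasic hx
        exact ⟨⟨(J, _), hJ, hJU⟩, hxJ⟩)
      (fun i => b i.1.1 i.1.2 i.2.1 ≫ mapLE G i.2.2)
      (fun i j x hi hj => by
        obtain ⟨J, hJ, hxJ, hJU⟩ := exists_isBasic (U := i.1.1 ⊓ j.1.1) (x := x) ⟨hi, hj⟩
        refine ⟨J, hJU.trans inf_le_left, hJU.trans inf_le_right, hxJ, ?_⟩
        rw [← Category.assoc, ← Category.assoc, hbn hJ, hbn hJ, Category.assoc, Category.assoc,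
          mapLE_comp, mapLE_comp])
    exact ⟨a, fun J z hJ h => ha ⟨(J, z), hJ, h⟩⟩
  choose a ha using hα
  refine ⟨natTransOfLE a fun {U V} h => hF.hom_ext fun x hx => ?_, fun z => ?_⟩
  · obtain ⟨J, hJ, hxJ, hJU⟩ := exists_isBasic hx
    refine ⟨J, hJU, hxJ, ?_⟩
    rw [mapLE_comp_assoc, ha V J _ hJ, ← Category.assoc, ha U J _ hJ, Category.assoc, mapLE_comp]
  · have h1 := ha (star z) (star z) z (isBasic_star z) le_rfl
    rw [hb, mapLE_self, Category.id_comp, Category.id_comp] at h1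
    exact h1

end Cosheaf

/-! ### Descent and invariance imply constructibility -/

namespace Cosheaf

open ZZN

variable {C : Type u} [Category.{v} C]

section

variable [HasLimitsOfSize.{0, 0} C] [HasColimitsOfSize.{0, 0} C]

omit [HasLimitsOfSize.{0, 0} C] in
theorem nonempty_iso_constant_of_cell_eq {F : Opens (TopCat.of ℝ) ⥤ C} (hF : HasDescent F)
    (hi : IsInvariant F) {Y : TopCat.{0}} {f : Y ⟶ TopCat.of ℝ} (hf : Topology.IsOpenEmbedding f)
    {z : ZZN} (hz : ∀ y, cell (f y) = z) :
    Nonempty (hf.isOpenMap.functor ⋙ F ≅ constant Y (F.obj (star z))) := by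
  have : LocallyConnectedSpace Y := hf.locallyConnectedSpace
  have hb : ∀ J : Opens Y, _root_.IsConnected (J : Set Y) →
      IsBasic (hf.isOpenMap.functor.obj J) z := by
    intro J hJ
    have hJ' : _root_.IsConnected (hf.isOpenMap.functor.obj J : Set ℝ) :=
      hJ.image _ hf.continuous.continuousOn
    have hsub : ∀ y ∈ hf.isOpenMap.functor.obj J, cell y = z := by
      rintro _ ⟨w, -, rfl⟩
      exact hz w
    obtain ⟨y, hy⟩ := hJ'.nonempty
    exact ⟨hJ'.isPreconnected.ordConnected, fun y hy => mem_star.2 (hsub y hy).le,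
      y, hy, hsub y hy⟩
  exact nonempty_iso_constant (hF.comp_functor hf)
    (fun J hJ => @asIso _ _ _ _ (mapLE F (hb J hJ).le_star) (hi.isIso_star (hb J hJ)))
    (fun J K hJ hK h => mapLE_comp F (hf.isOpenMap.functor.monotone h) (hb K hK).le_star)

theorem isLocallyConstant_of_isOpen {F : Opens (TopCat.of ℝ) ⥤ C} (hF : HasDescent F)
    (hi : IsInvariant F) {A : Set ℝ} (hA : IsOpen A) {z : ZZN} (hAz : A = {y | cell y = z}) :
    IsLocallyConstant (restrict (X := TopCat.of ℝ) F A) := by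
  intro x
  have hA' := isOpenEmbedding_ofHom_val (X := TopCat.of ℝ) hA
  have hU := isOpenEmbedding_ofHom_val (⊤ : Opens (TopCat.of A)).2
  have hUA : Topology.IsOpenEmbedding
      (TopCat.ofHom ⟨Subtype.val, continuous_subtype_val⟩ ≫
        TopCat.ofHom ⟨Subtype.val, continuous_subtype_val⟩ :
          TopCat.of ((⊤ : Opens (TopCat.of A)) : Set (TopCat.of A)) ⟶ TopCat.of ℝ) :=
    hA'.comp hU
  obtain ⟨ψ⟩ := nonempty_iso_constant_of_cell_eq hF hi hUA (z := z) fun w =>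
    show (w.1.1 : ℝ) ∈ {y | cell y = z} from hAz ▸ w.1.2
  exact ⟨⊤, trivial, _, ⟨pullbackPullbackIso hU.isOpenMap hA'.isOpenMap hUA.isOpenMap F ≪≫ ψ⟩⟩

theorem isLocallyConstant_of_subsingleton {X : TopCat.{0}} {F : Opens X ⥤ C} (hF : HasDescent F)
    {A : Set X} (hA : A.Subsingleton) : IsLocallyConstant (restrict F A) := by
  intro x
  have : Subsingleton (TopCat.of A) := hA.coe_sort
  let Y := TopCat.of ((⊤ : Opens (TopCat.of A)) : Set (TopCat.of A))
  have : Subsingleton Y := inferInstanceAs (Subsingleton (Set.univ : Set (TopCat.of A)))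
  have : DiscreteTopology Y := inferInstance
  have hU := isOpenEmbedding_ofHom_val (⊤ : Opens (TopCat.of A)).2
  let G : Opens Y ⥤ C := hU.isOpenMap.functor ⋙ restrict F A
  -- the empty set is the smallest of the open sets over which the limit is taken
  let i₀ : StructuredArrow (hU.isOpenMap.functor.obj ⊥)
      (Opens.map (TopCat.ofHom ⟨Subtype.val, continuous_subtype_val⟩ : TopCat.of A ⟶ X)) :=
    StructuredArrow.mk (Y := ⊥) (homOfLE (by rintro _ ⟨_, h, -⟩; exact h.elim))
  have h₀ : IsInitial i₀ := IsInitial.ofUniqueHom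
    (fun B => StructuredArrow.homMk (homOfLE bot_le) rfl) (fun _ _ => StructuredArrow.hom_ext _ _ rfl)
  obtain ⟨hbot⟩ := hF.nonempty_isInitial_bot
  have hG : IsInitial (G.obj ⊥) := hbot.ofIso
    (@asIso _ _ (G.obj ⊥) (F.obj ⊥) (limit.π (StructuredArrow.proj _ _ ⋙ F) i₀)
      (isIso_π_of_isInitial h₀ _)).symm
  have htop : ∀ J : Opens Y, _root_.IsConnected (J : Set Y) → J = ⊤ := fun J hJ => by
    obtain ⟨y, hy⟩ := hJ.nonempty
    exact top_le_iff.1 fun w _ => Subsingleton.elim y w ▸ hy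
  obtain ⟨ψ⟩ := nonempty_iso_constant (hasDescent_of_subsingleton hG) (V := G.obj ⊤)
    (fun J hJ => @asIso _ _ _ _ (mapLE G le_top) (isIso_mapLE_of_eq G (htop J hJ)))
    (fun J K hJ hK h => mapLE_comp G h le_top)
  exact ⟨⊤, trivial, G.obj ⊤, ⟨pullbackIso hU.isOpenMap _ ≪≫ ψ⟩⟩

theorem isConstructible_iff {F : Opens (TopCat.of ℝ) ⥤ C} :
    isConstructible C realStrat F ↔ HasDescent F ∧ IsInvariant F := by
  refine ⟨fun h => ⟨isCosheaf_iff_hasDescent.1 h.1, isInvariant_of_isConstructible h⟩, ?_⟩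
  rintro ⟨hF, hi⟩
  refine ⟨isCosheaf_iff_hasDescent.2 hF, fun p x => ?_⟩
  obtain ⟨x, rfl⟩ := x
  refine (?_ : IsLocallyConstant _) _
  by_cases ho : Odd (cell x).num
  · exact isLocallyConstant_of_isOpen hF hi (isOpen_stratum ho) (stratum_map x)
  · refine isLocallyConstant_of_subsingleton hF ?_
    change (realStrat.stratum (Ambient.map natNative x)).Subsingleton
    rw [stratum_map]
    intro y hy w hw
    have hy : cell y = cell x := hy
    exact eq_of_cell_eq_of_even (hy.trans (show cell w = cell x from hw).symm) (hy ▸ ho)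

end

theorem _root_.ZZN.IsBasic.cell_le {J : Opens (TopCat.of ℝ)} {z : ZZN} (hJ : IsBasic J z) {x : ℝ}
    (hx : x ∈ J) : cell x ≤ z := mem_star.1 (hJ.le_star hx)

/-! ### The cosheaf of a representation -/

/-- An interval together with the index of the smallest stratum that it meets. -/
structure BasicOpen where
  carrier : Opens (TopCat.of ℝ)
  index : ZZN
  isBasic : IsBasic carrier index

instance : Preorder BasicOpen := Preorder.lift BasicOpen.carrier

theorem BasicOpen.index_mono : Monotone BasicOpen.index := fun a b h =>
  a.isBasic.le_of_le b.isBasic h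

theorem BasicOpen.carrier_mono : Monotone BasicOpen.carrier := fun _ _ h => h

variable [HasColimitsOfSize.{0, 0} C]

/-- The cosheaf with value `ρ z` on the intervals whose smallest stratum is `z`: the left Kan
extension from the intervals to all open sets. -/
noncomputable def extend (ρ : ZZN ⥤ C) : Opens (TopCat.of ℝ) ⥤ C :=
  (BasicOpen.carrier_mono.functor).pointwiseLeftKanExtension (BasicOpen.index_mono.functor ⋙ ρ)

section

variable (ρ : ZZN ⥤ C) {J K U W : Opens (TopCat.of ℝ)} {z w : ZZN}

/-- An interval `J` contained in `U`, as an object of the category over which the colimit that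
defines `extend ρ` on `U` is taken. -/
def basicArrow (hJ : IsBasic J z) (h : J ≤ U) :
    CostructuredArrow BasicOpen.carrier_mono.functor U :=
  CostructuredArrow.mk
    (homOfLE h : BasicOpen.carrier_mono.functor.obj (⟨J, z, hJ⟩ : BasicOpen) ⟶ U)

/-- The structure map of the colimit that defines `extend ρ` on `U`. -/
noncomputable def extendι (hJ : IsBasic J z) (h : J ≤ U) : ρ.obj z ⟶ (extend ρ).obj U :=
  colimit.ι (CostructuredArrow.proj BasicOpen.carrier_mono.functor U ⋙
    BasicOpen.index_mono.functor ⋙ ρ) (basicArrow hJ h)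

theorem extendι_mapLE (hJ : IsBasic J z) (h : J ≤ U) (h' : U ≤ W) :
    extendι ρ hJ h ≫ mapLE (extend ρ) h' = extendι ρ hJ (h.trans h') :=
  colimit.ι_desc (F := CostructuredArrow.proj BasicOpen.carrier_mono.functor U ⋙
    BasicOpen.index_mono.functor ⋙ ρ) _ (basicArrow hJ h)

theorem extendι_mapLE_assoc (hJ : IsBasic J z) (h : J ≤ U) (h' : U ≤ W) {T : C}
    (f : (extend ρ).obj W ⟶ T) :
    extendι ρ hJ h ≫ mapLE (extend ρ) h' ≫ f = extendι ρ hJ (h.trans h') ≫ f := by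
  rw [← Category.assoc, extendι_mapLE]

theorem mapLE_extendι (hJ : IsBasic J z) (hK : IsBasic K w) (h : J ≤ K) (h' : K ≤ U)
    (hzw : z ≤ w) : mapLE ρ hzw ≫ extendι ρ hK h' = extendι ρ hJ (h.trans h') :=
  colimit.w (CostructuredArrow.proj BasicOpen.carrier_mono.functor U ⋙
    BasicOpen.index_mono.functor ⋙ ρ)
    (CostructuredArrow.homMk (f := basicArrow hJ (h.trans h')) (f' := basicArrow hK h')
      (homOfLE (show (⟨J, z, hJ⟩ : BasicOpen) ≤ ⟨K, w, hK⟩ from h)) rfl)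

theorem extendι_eq (hJ : IsBasic J z) (hK : IsBasic K z) (h : J ≤ K) (h' : K ≤ U) :
    extendι ρ hK h' = extendι ρ hJ (h.trans h') := by
  rw [← mapLE_extendι ρ hJ hK h h' le_rfl, mapLE_self, Category.id_comp]

variable {ρ}

theorem extend_hom_ext {T : C} {f g : (extend ρ).obj U ⟶ T}
    (h : ∀ J z (hJ : IsBasic J z) (h : J ≤ U), extendι ρ hJ h ≫ f = extendι ρ hJ h ≫ g) :
    f = g :=
  colimit.hom_ext (F := CostructuredArrow.proj BasicOpen.carrier_mono.functor U ⋙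
    BasicOpen.index_mono.functor ⋙ ρ)
    fun ⟨b, _, i⟩ => h b.carrier b.index b.isBasic i.le

theorem exists_extend_desc {T : C} (t : ∀ J z, IsBasic J z → J ≤ U → (ρ.obj z ⟶ T))
    (ht : ∀ J K z w (hJ : IsBasic J z) (hK : IsBasic K w) (_ : J ≤ K) (h' : K ≤ U) (hU : J ≤ U)
      (hzw : z ≤ w), mapLE ρ hzw ≫ t K w hK h' = t J z hJ hU) :
    ∃ f : (extend ρ).obj U ⟶ T, ∀ J z (hJ : IsBasic J z) (h : J ≤ U),
      extendι ρ hJ h ≫ f = t J z hJ h :=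
  ⟨colimit.desc (CostructuredArrow.proj BasicOpen.carrier_mono.functor U ⋙
    BasicOpen.index_mono.functor ⋙ ρ) ⟨T,
    { app := fun j => t j.left.carrier j.left.index j.left.isBasic j.hom.le
      naturality := fun i j f => (ht _ _ _ _ i.left.isBasic j.left.isBasic f.left.le j.hom.le
        i.hom.le (BasicOpen.index_mono f.left.le)).trans (Category.comp_id _).symm }⟩,
    fun _ _ hJ h => colimit.ι_desc (F := CostructuredArrow.proj BasicOpen.carrier_mono.functor U ⋙
      BasicOpen.index_mono.functor ⋙ ρ) _ (basicArrow hJ h)⟩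

variable (ρ)

theorem isIso_extendι_self (hJ : IsBasic J z) : IsIso (extendι ρ hJ (le_refl J)) := by
  obtain ⟨d, hd⟩ := exists_extend_desc (ρ := ρ) (U := J)
    (fun K w hK h => mapLE ρ (hK.le_of_le hJ h))
    (fun _ _ _ _ _ _ _ _ _ _ => mapLE_comp _ _ _)
  refine ⟨d, (hd _ _ _ _).trans (mapLE_self _ _), extend_hom_ext fun K w hK h => ?_⟩
  rw [← Category.assoc, hd, Category.comp_id]
  exact mapLE_extendι ρ hK hJ h le_rfl _

theorem isInvariant_extend : IsInvariant (extend ρ) := by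
  intro J K z hJ hK h
  have := isIso_extendι_self ρ hJ
  have : IsIso (extendι ρ hJ (le_refl J) ≫ mapLE (extend ρ) h) := by
    rw [extendι_mapLE, ← extendι_eq ρ hJ hK h le_rfl]
    exact isIso_extendι_self ρ hK
  exact IsIso.of_isIso_comp_left (extendι ρ hJ (le_refl J)) _

/-- A compatible family of maps on an open cover is determined by its germs, one map out of
`ρ (cell x)` for each point `x`. The germs near `x` are induced by the germ at `x`, and along an
interval this propagates to all points from any point of the smallest stratum. -/
theorem hasDescent_extend : HasDescent (extend ρ) := by
  intro ι U W hU hW T t ht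
  -- the germs of the family
  have germ : ∀ x ∈ W, ∃ s : ρ.obj (cell x) ⟶ T, ∀ i J z (hJ : IsBasic J z) (hJi : J ≤ U i)
      (hx : x ∈ J), s = mapLE ρ (hJ.cell_le hx) ≫ extendι ρ hJ hJi ≫ t i := by
    intro x hx
    obtain ⟨j, hj⟩ := hW x hx
    obtain ⟨K, hK, hxK, hKj⟩ := exists_isBasic hj
    refine ⟨extendι ρ hK hKj ≫ t j, fun i J z hJ hJi hxJ => ?_⟩
    obtain ⟨L, hL, hxL, hLK⟩ := exists_isBasic (U := K ⊓ J) (x := x) ⟨hxK, hxJ⟩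
    have hLj : L ≤ U i ⊓ U j :=
      le_inf (hLK.trans (inf_le_right.trans hJi)) (hLK.trans (inf_le_left.trans hKj))
    have h := congrArg (extendι ρ hL hLj ≫ ·) (ht i j)
    rw [extendι_mapLE_assoc, extendι_mapLE_assoc] at h
    rw [extendι_eq ρ hL hK (hLK.trans inf_le_left), ← h, ← Category.assoc,
      mapLE_extendι ρ hL hJ (hLK.trans inf_le_right) hJi]
  choose s hs using germ
  -- the germ of a nearby point
  have near : ∀ x (hx : x ∈ W), ∀ᶠ y in nhds x, ∃ (hy : y ∈ W) (h : cell y ≤ cell x),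
      s y hy = mapLE ρ h ≫ s x hx := by
    intro x hx
    obtain ⟨i, hi⟩ := hW x hx
    obtain ⟨J, hJ, hxJ, hJi⟩ := exists_isBasic hi
    filter_upwards [J.2.mem_nhds hxJ] with y hy
    refine ⟨hU i (hJi hy), hJ.cell_le hy, ?_⟩
    rw [hs y _ i J _ hJ hJi hy, hs x hx i J _ hJ hJi hxJ, mapLE_self, Category.id_comp]
  -- all germs along an interval are induced by one map
  have along : ∀ J z, IsBasic J z → ∀ hJW : J ≤ W, ∃ r : ρ.obj z ⟶ T,
      ∀ x (hx : x ∈ J) (h : cell x ≤ z), s x (hJW hx) = mapLE ρ h ≫ r := by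
    intro J z hJ hJW
    obtain ⟨x₀, hx₀, rfl⟩ := hJ.exists_mem
    refine ⟨s x₀ (hJW hx₀), fun x hx => ?_⟩
    refine hJ.induction (fun x => ∀ (hx : x ∈ W) (h : cell x ≤ cell x₀),
      s x hx = mapLE ρ h ≫ s x₀ (hJW hx₀)) hx₀ rfl ?_ ?_ ?_ hx (hJW hx)
    · intro _ h
      rw [mapLE_self, Category.id_comp]
    · intro x hx hp
      filter_upwards [near x (hJW hx)] with y hy _ h
      obtain ⟨_, hyx, e⟩ := hy
      rw [e, hp (hJW hx) (hJ.cell_le hx), mapLE_comp_assoc]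
    · intro x hx ho
      filter_upwards [near x (hJW hx)] with y hy hp _ h
      obtain ⟨hyW, hyx, e⟩ := hy
      have := isIso_mapLE_of_eq ρ (eq_of_le_odd hyx ho)
      rw [← cancel_epi (mapLE ρ hyx), ← e, hp hyW (hyx.trans h), mapLE_comp_assoc]
  choose r hr using along
  have hrs : ∀ J z (hJ : IsBasic J z) (hJW : J ≤ W) (q : ρ.obj z ⟶ T),
      (∀ x (hx : x ∈ J) (h : cell x ≤ z), cell x = z → s x (hJW hx) = mapLE ρ h ≫ q) →
      r J z hJ hJW = q := by
    intro J z hJ hJW q hq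
    obtain ⟨x, hx, rfl⟩ := hJ.exists_mem
    have := hq x hx le_rfl rfl
    rw [hr J _ hJ hJW x hx le_rfl, mapLE_self, Category.id_comp, Category.id_comp] at this
    exact this
  obtain ⟨f, hf⟩ := exists_extend_desc (ρ := ρ) (U := W) r fun J K z w hJ hK hJK hKW hJW hzw => by
    refine (hrs J z hJ hJW _ fun x hx h _ => ?_).symm
    rw [hr K w hK hKW x (hJK hx) (h.trans hzw), mapLE_comp_assoc]
  refine ⟨f, fun i => extend_hom_ext fun J z hJ h => ?_, fun g hg => ?_⟩
  · rw [← Category.assoc, extendι_mapLE, hf]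
    exact hrs J z hJ _ _ fun x hx hxz _ => hs x _ i J z hJ h hx
  · refine extend_hom_ext fun J z hJ h => ?_
    rw [hf]
    refine (hrs J z hJ h _ fun x hx hxz e => ?_).symm
    obtain ⟨i, hi⟩ := hW x (h hx)
    obtain ⟨K, hK, hxK, hKJ⟩ := exists_isBasic (U := J ⊓ U i) (x := x) ⟨hx, hi⟩
    rw [← Category.assoc, mapLE_extendι ρ hK hJ (hKJ.trans inf_le_left),
      hs x (h hx) i K _ hK (hKJ.trans inf_le_right) hxK, mapLE_self, Category.id_comp, ← hg i,
      ← Category.assoc, extendι_mapLE]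

/-- The restriction of `extend ρ` to the open stars is `ρ`. -/
noncomputable def starExtendIso : ρ ≅ star_mono.functor ⋙ extend ρ :=
  NatIso.ofComponents
    (fun z => @asIso _ _ _ _ (extendι ρ (isBasic_star z) le_rfl)
      (isIso_extendι_self ρ (isBasic_star z)))
    (fun {z w} h => by
      change mapLE ρ h.le ≫ extendι ρ (isBasic_star w) le_rfl =
        extendι ρ (isBasic_star z) le_rfl ≫ mapLE (extend ρ) (star_mono h.le)
      rw [extendι_mapLE, mapLE_extendι ρ (isBasic_star z) (isBasic_star w) (star_mono h.le)])

end

end Cosheaf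

/-! ### Costalks -/

namespace Cosheaf

open ZZN

variable {C : Type u} [Category.{v} C]

section

variable [HasLimitsOfSize.{0, 0} C] {X : TopCat.{0}} {F : Opens X ⥤ C} {x : X} {U V : Opens X}

variable (F) in
/-- The projection from the costalk at `x` to the value on an open neighbourhood of `x`. -/
noncomputable def costalkπ (hx : x ∈ U) : costalk F x ⟶ F.obj U :=
  limit.π (OpenNhds.inclusion x ⋙ F) (show OpenNhds x from ⟨U, hx⟩)

theorem costalkπ_mapLE (hx : x ∈ U) (h : U ≤ V) :
    costalkπ F hx ≫ mapLE F h = costalkπ F (h hx) :=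
  limit.w (OpenNhds.inclusion x ⋙ F)
    (homOfLE h : (show OpenNhds x from ⟨U, hx⟩) ⟶ (show OpenNhds x from ⟨V, h hx⟩))

theorem costalk_hom_ext {T : C} {f g : T ⟶ costalk F x}
    (h : ∀ U (hx : x ∈ U), f ≫ costalkπ F hx = g ≫ costalkπ F hx) : f = g :=
  limit.hom_ext fun N => h N.1 N.2

theorem exists_costalk_lift {T : C} (m : ∀ U, x ∈ U → (T ⟶ F.obj U))
    (hm : ∀ U V hU hV (h : U ≤ V), m U hU ≫ mapLE F h = m V hV) :
    ∃ f : T ⟶ costalk F x, ∀ U hU, f ≫ costalkπ F hU = m U hU :=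
  ⟨limit.lift (OpenNhds.inclusion x ⋙ F) ⟨T,
    { app := fun N => m N.1 N.2
      naturality := fun N N' h => (Category.id_comp _).trans (hm _ _ N.2 N'.2 h.le).symm }⟩,
    fun _ _ => limit.lift_π _ _⟩

end

/-- The costalk at `x` is the value on the open star of the stratum of `x`: the intervals around
`x` in this star form a neighbourhood basis on which the values are constant. -/
theorem isIso_costalkπ [HasLimitsOfSize.{0, 0} C] {F : Opens (TopCat.of ℝ) ⥤ C}
    (hF : IsInvariant F) (x : ℝ) :
    IsIso (costalkπ F (x := x) (U := star (cell x)) (mem_star.2 le_rfl)) := by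
  have key : ∀ N : Opens (TopCat.of ℝ), x ∈ N → ∃ m : F.obj (star (cell x)) ⟶ F.obj N,
      ∀ J (hJ : IsBasic J (cell x)), x ∈ J → ∀ h : J ≤ N,
        mapLE F hJ.le_star ≫ m = mapLE F h := by
    intro N hN
    obtain ⟨J, hJ, hxJ, hJN⟩ := exists_isBasic hN
    have := hF.isIso_star hJ
    refine ⟨inv (mapLE F hJ.le_star) ≫ mapLE F hJN, fun K hK hxK hKN => ?_⟩
    obtain ⟨L, hL, -, hLJK⟩ := exists_isBasic (U := J ⊓ K) (x := x) ⟨hxJ, hxK⟩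
    have := hF hL hK (hLJK.trans inf_le_right)
    rw [← cancel_epi (mapLE F (hLJK.trans inf_le_right)), mapLE_comp_assoc, mapLE_comp,
      ← mapLE_comp_assoc F (hLJK.trans inf_le_left) hJ.le_star, IsIso.hom_inv_id_assoc, mapLE_comp]
  choose m hm using key
  have hmc : ∀ N N' hN hN' (h : N ≤ N'), m N hN ≫ mapLE F h = m N' hN' := by
    intro N N' hN hN' h
    obtain ⟨J, hJ, hxJ, hJN⟩ := exists_isBasic hN
    have := hF.isIso_star hJ
    rw [← cancel_epi (mapLE F hJ.le_star), ← Category.assoc, hm N hN J hJ hxJ hJN,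
      hm N' hN' J hJ hxJ (hJN.trans h), mapLE_comp]
  obtain ⟨f, hf⟩ := exists_costalk_lift m hmc
  refine ⟨f, costalk_hom_ext fun N hN => ?_, ?_⟩
  · obtain ⟨J, hJ, hxJ, hJN⟩ := exists_isBasic hN
    rw [Category.assoc, hf, Category.id_comp, ← costalkπ_mapLE hxJ hJ.le_star, Category.assoc,
      hm N hN J hJ hxJ hJN, costalkπ_mapLE]
  · have h := hm _ (mem_star.2 le_rfl) _ (isBasic_star (cell x)) (mem_star.2 le_rfl) le_rfl
    rwa [mapLE_self, Category.id_comp, ← hf] at h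

/-! ### The equivalence with constructible cosheaves -/

section

variable [HasLimitsOfSize.{0, 0} C] [HasColimitsOfSize.{0, 0} C]

/-- The restriction of precosheaves to the open stars of the strata. -/
noncomputable def starRestriction (P : ObjectProperty (Opens (TopCat.of ℝ) ⥤ C)) :
    P.FullSubcategory ⥤ (ZZN ⥤ C) :=
  P.ι ⋙ (Functor.whiskeringLeft _ _ C).obj star_mono.functor

variable {P : ObjectProperty (Opens (TopCat.of ℝ) ⥤ C)}

theorem faithful_starRestriction (hP : P ≤ isConstructible C realStrat) :
    (starRestriction P).Faithful where
  map_injective {F G α β} h := by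
    refine ObjectProperty.hom_ext _ (hom_ext_star (isConstructible_iff.1 (hP _ F.2)).1
      (isConstructible_iff.1 (hP _ G.2)).2 fun z => ?_)
    exact congrArg (fun γ => γ.app z) h

theorem full_starRestriction (hP : P ≤ isConstructible C realStrat) :
    (starRestriction P).Full where
  map_surjective {F G} τ := by
    obtain ⟨α, hα⟩ := exists_hom_of_star (isConstructible_iff.1 (hP _ F.2)).1
      (isConstructible_iff.1 (hP _ G.2)).2 τ.app (fun h => τ.naturality (homOfLE h))
    refine ⟨ObjectProperty.homMk α, ?_⟩
    ext z
    exact hα z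

theorem isConstructible_extend (ρ : ZZN ⥤ C) : isConstructible C realStrat (extend ρ) :=
  isConstructible_iff.2 ⟨hasDescent_extend ρ, isInvariant_extend ρ⟩

variable (C) in
/-- Representations of the poset of half-integers are the same as constructible cosheaves on the
stratified real line. -/
theorem nonempty_equivalence : Nonempty ((ZZN ⥤ C) ≌ ConstructibleCosheaf realStrat C) := by
  have := faithful_starRestriction (le_refl (isConstructible C realStrat))
  have := full_starRestriction (le_refl (isConstructible C realStrat))
  have : (starRestriction (isConstructible C realStrat)).EssSurj :=
    ⟨fun ρ => ⟨⟨extend ρ, isConstructible_extend ρ⟩, ⟨(starExtendIso ρ).symm⟩⟩⟩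
  have : (starRestriction (isConstructible C realStrat)).IsEquivalence := {}
  exact ⟨(starRestriction (isConstructible C realStrat)).asEquivalence.symm⟩

end

theorem nonempty_equivalence_of_essImage_eq {A B D : Type*} [Category* A] [Category* B]
    [Category* D] (F : A ⥤ D) (G : B ⥤ D) [F.Full] [F.Faithful] [G.Full] [G.Faithful]
    (h : F.essImage = G.essImage) : Nonempty (A ≌ B) := by
  have : F.toEssImage.IsEquivalence := {}
  have : G.toEssImage.IsEquivalence := {}
  have key : ∀ {P Q : ObjectProperty D}, P = Q →
      Nonempty (P.FullSubcategory ≌ Q.FullSubcategory) := by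
    rintro P _ rfl
    exact ⟨CategoryTheory.Equivalence.refl⟩
  obtain ⟨e⟩ := key h
  exact ⟨F.toEssImage.asEquivalence.trans (e.trans G.toEssImage.asEquivalence.symm)⟩

section

variable (k : Type u) [Field k]

theorem finite_of_iso {V W : ModuleCat.{u} k} (e : V ≅ W) [Module.Finite k V] :
    Module.Finite k W := Module.Finite.equiv e.toLinearEquiv

theorem essImage_starRestriction_finite :
    (starRestriction (isConstructibleFinite k realStrat)).essImage =
      fun ρ : ZZN ⥤ ModuleCat.{u} k => ∀ z, Module.Finite k (ρ.obj z) := by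
  ext ρ
  constructor
  · rintro ⟨F, ⟨e⟩⟩ z
    have h := F.2.2 z.toReal
    have hi := isIso_costalkπ (isConstructible_iff.1 F.2.1).2 z.toReal
    have : Module.Finite k (F.obj.obj (star (cell z.toReal))) :=
      @finite_of_iso k _ _ _ (@asIso _ _ _ _ _ hi) h
    rw [cell_toReal] at this
    exact finite_of_iso k (V := F.obj.obj (star z)) (e.app z)
  · intro h
    refine ⟨⟨extend ρ, isConstructible_extend ρ, fun x => ?_⟩, ⟨(starExtendIso ρ).symm⟩⟩
    have hi := isIso_costalkπ (isInvariant_extend ρ) x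
    have := h (cell x)
    have : Module.Finite k ((extend ρ).obj (star (cell x))) :=
      finite_of_iso k ((starExtendIso ρ).app (cell x))
    exact @finite_of_iso k _ _ _ (@asIso _ _ _ _ _ hi).symm this

theorem essImage_whiskeringRight_finite :
    ((Functor.whiskeringRight ZZN _ _).obj (ModuleCat.isFG k).ι).essImage =
      fun ρ : ZZN ⥤ ModuleCat.{u} k => ∀ z, Module.Finite k (ρ.obj z) := by
  ext ρ
  constructor
  · rintro ⟨η, ⟨e⟩⟩ z
    have : Module.Finite k (η.obj z).obj := (η.obj z).2
    exact finite_of_iso k (V := (η.obj z).obj) (e.app z)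
  · intro h
    exact ⟨(ModuleCat.isFG k).lift ρ h, ⟨Iso.refl _⟩⟩

/-- The equivalence of `nonempty_equivalence` matches the representations by finite-dimensional
vector spaces with the cosheaves with finite-dimensional costalks. -/
theorem nonempty_equivalence_finite :
    Nonempty ((ZZN ⥤ FGModuleCat.{u} k) ≌ FiniteConstructibleCosheaf realStrat k) := by
  have hP : isConstructibleFinite k realStrat ≤ isConstructible (ModuleCat.{u} k) realStrat :=
    fun _ h => h.1
  have := faithful_starRestriction hP
  have := full_starRestriction hP
  exact nonempty_equivalence_of_essImage_eq
    ((Functor.whiskeringRight ZZN _ _).obj (ModuleCat.isFG k).ι)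
    (starRestriction (isConstructibleFinite k realStrat))
    ((essImage_whiskeringRight_finite k).trans (essImage_starRestriction_finite k).symm)

end

end Cosheaf

/-! ### Representations of the entrance path category -/

/-- Restriction along an isomorphism of preorders is an isomorphism of functor categories. -/
theorem OrderIso.exists_whiskeringLeft_inverse {P Q : Type*} [Preorder P] [Preorder Q]
    (e : P ≃o Q) (C : Type u) [Category.{v} C] :
    ∃ Θ : (P ⥤ C) ⥤ (Q ⥤ C),
      (Functor.whiskeringLeft _ _ C).obj e.monotone.functor ⋙ Θ = 𝟭 _ ∧
      Θ ⋙ (Functor.whiskeringLeft _ _ C).obj e.monotone.functor = 𝟭 _ := by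
  have h₁ : e.symm.monotone.functor ⋙ e.monotone.functor = 𝟭 Q :=
    CategoryTheory.Functor.ext (fun q => e.apply_symm_apply q) fun _ _ _ => Subsingleton.elim _ _
  have h₂ : e.monotone.functor ⋙ e.symm.monotone.functor = 𝟭 P :=
    CategoryTheory.Functor.ext (fun p => e.symm_apply_apply p) fun _ _ _ => Subsingleton.elim _ _
  refine ⟨(Functor.whiskeringLeft _ _ C).obj e.symm.monotone.functor, ?_, ?_⟩
  · exact (congrArg (Functor.whiskeringLeft _ _ C).obj h₁ :)
  · exact (congrArg (Functor.whiskeringLeft _ _ C).obj h₂ :)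

theorem mainTheorem5 (k : Type u) [Field k] :
    ∃ e : ZZN ≃o realStrat.Ent, (∀ z : ZZN, e z = realStrat.entOf z.toReal) ∧
      -- arbitrary vector spaces
      ((∃ h : (ZZMod.weakEquivalences (ModuleCat.{u} k)).IsInvertedBy
            (ZZMod.pullback (ModuleCat.{u} k)),
          (Localization.Construction.lift (ZZMod.pullback (ModuleCat.{u} k)) h).IsEquivalence ∧
          ∃ Ψ : (ZZN ⥤ ModuleCat.{u} k) ⥤
              (ZZMod.weakEquivalences (ModuleCat.{u} k)).Localization,
            Ψ ⋙ Localization.Construction.lift (ZZMod.pullback (ModuleCat.{u} k)) h = 𝟭 _) ∧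
        (∃ Θ : (ZZN ⥤ ModuleCat.{u} k) ⥤ (realStrat.Ent ⥤ ModuleCat.{u} k),
          (Functor.whiskeringLeft _ _ (ModuleCat.{u} k)).obj e.monotone.functor ⋙ Θ = 𝟭 _ ∧
          Θ ⋙ (Functor.whiskeringLeft _ _ (ModuleCat.{u} k)).obj e.monotone.functor = 𝟭 _) ∧
        Nonempty ((realStrat.Ent ⥤ ModuleCat.{u} k) ≌
          ConstructibleCosheaf realStrat (ModuleCat.{u} k))) ∧
      -- finite-dimensional vector spaces
      ((∃ h : (ZZMod.weakEquivalences (FGModuleCat.{u} k)).IsInvertedBy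
            (ZZMod.pullback (FGModuleCat.{u} k)),
          (Localization.Construction.lift (ZZMod.pullback (FGModuleCat.{u} k)) h).IsEquivalence ∧
          ∃ Ψ : (ZZN ⥤ FGModuleCat.{u} k) ⥤
              (ZZMod.weakEquivalences (FGModuleCat.{u} k)).Localization,
            Ψ ⋙ Localization.Construction.lift (ZZMod.pullback (FGModuleCat.{u} k)) h = 𝟭 _) ∧
        (∃ Θ : (ZZN ⥤ FGModuleCat.{u} k) ⥤ (realStrat.Ent ⥤ FGModuleCat.{u} k),
          (Functor.whiskeringLeft _ _ (FGModuleCat.{u} k)).obj e.monotone.functor ⋙ Θ = 𝟭 _ ∧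
          Θ ⋙ (Functor.whiskeringLeft _ _ (FGModuleCat.{u} k)).obj e.monotone.functor = 𝟭 _) ∧
        Nonempty ((realStrat.Ent ⥤ FGModuleCat.{u} k) ≌
          FiniteConstructibleCosheaf realStrat k)) := by
  have E : ∀ (C : Type (u + 1)) [Category.{u} C], (realStrat.Ent ⥤ C) ≌ (ZZN ⥤ C) :=
    fun C _ => ZZN.entIso.equivalence.symm.congrLeft
  refine ⟨ZZN.entIso, fun _ => rfl, ⟨ZZMod.isEquivalence_lift_pullback _,
    ZZN.entIso.exists_whiskeringLeft_inverse _, ?_⟩, ⟨ZZMod.isEquivalence_lift_pullback _,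
    ZZN.entIso.exists_whiskeringLeft_inverse _, ?_⟩⟩
  · obtain ⟨e⟩ := Cosheaf.nonempty_equivalence (ModuleCat.{u} k)
    exact ⟨(E _).trans e⟩
  · obtain ⟨e⟩ := Cosheaf.nonempty_equivalence_finite k
    exact ⟨(E _).trans e⟩
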